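/- **Valence formula for rational weights.** Let $D\ge 1$ be an integer, $k\in\frac1D\mathbb Z$, and $G\le SL_2(\mathbb Z)$ a subgroup of finite index. Let $\widetilde{SL_2(\mathbb Z)}$ be the $D$-cover, the group of pairs $(\gamma,\varphi)$ with $\gamma=\begin{pmatrix}a&b\\c&d\end{pmatrix}\in SL_2(\mathbb Z)$ and $\varphi(\tau)=\varepsilon(c\tau+d)^{1/D}$ (principal branch, $\varepsilon^D=1$) on the upper half plane $\mathfrak H$, with product $(\gamma_1,\varphi_1)(\gamma_2,\varphi_2)=(\gamma_1\gamma_2,\varphi_1(\gamma_2\tau)\varphi_2(\tau))$; let $\widetilde G$ be the preimage of $G$, $\widetilde\gamma=(\gamma,(c\tau+d)^{1/D})$, and $f|_k(\gamma,\varphi)(\tau)=\varphi(\tau)^{-Dk}f(\gamma\tau)$. Let $\chi$ be a unitary character of $\widetilde G$ (not necessarily of finite order), and let $f$ be a nonzero meromorphic modular form of weight $k$ for $G$ with character $\chi$: a nonzero meromorphic function on $\mathfrak H$ such that $f|_kg=\chi(g)f$ for all $g\in\widetilde G$ and such that, for every $g\in\widetilde{SL_2(\mathbb Z)}$, one has on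 some half plane $\operatorname{Im}\tau>Y$ a convergent expansion $$(f|_kg)(\tau)=\sum_{n\ge 0}c_n e^{2\pi i(r+n/w)\tau},\qquad c_0\ne 0,\ r\in\mathbb R,\ w\in\mathbb Z_{\ge1};$$ the number $r$ is denoted $\operatorname{ord}_{i\infty}(f|_kg)$. (Then $\chi$ is automatically a multiplier system of weight $k$: $\chi(I,e^{2\pi i/D})=e^{-2\pi ik}$, and $\chi(\widetilde{-I})=e^{-\pi ik}$ if $-I\in G$.) Denote by a bar images in $SL_2(\mathbb Z)/\{\pm I\}$, and put $X_G=G\backslash(\mathfrak H\cup\mathbb P^1(\mathbb Q))$. Then the following values depend only on the points of $X_G$ and define a function $\operatorname{div}(f)\colon X_G\to\mathbb R$ with finite support: $$\operatorname{div}_{G\tau}(f)=\frac{\operatorname{ord}_\tau f}{|\overline G_\tau|}\quad(\tau\in\mathfrak H),\qquad \operatorname{div}_{Gx}(f)=\operatorname{ord}_{i\infty}(f|_k\widetilde\gamma)\cdot[\overline{SL_2(\mathbb Z)}_x:\overline G_x]\quad(x=\gamma(i\infty)\in\mathbb P^1(\mathbb Q),\ \gamma\in SL_2(\mathbb Z)).$$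 If all values of $\chi$ are roots of unity, then $\operatorname{div}(f)$ is $\mathbb Q$-valued. With $m=[\overline{SL_2(\mathbb Z)}:\overline G]$, $$\deg(\operatorname{div} f)=\sum_{x\in X_G}\operatorname{div}_x(f)=\frac{mk}{12}.$$ -/

import Mathlib

open UpperHalfPlane
open scoped MatrixGroups OnePoint

namespace RationalWeight

noncomputable section

/-! ### The `D`-cover of `SL(2, ℤ)` -/

/-- The factor of automorphy `c τ + d` of a matrix with bottom row `(c, d)`. -/
def autFactor (γ : SL(2, ℤ)) (τ : ℍ) : ℂ := (γ 1 0 : ℂ) * (τ : ℂ) + (γ 1 1 : ℂ)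

/-- The function `τ ↦ (c τ + d) ^ (1 / D)`. The power is Mathlib's power of complex numbers, that is,
`exp ((1 / D) * log z)` with `-π < Im (log z) ≤ π`. -/
def rootFactor (D : ℕ) (γ : SL(2, ℤ)) (τ : ℍ) : ℂ := autFactor γ τ ^ (1 / (D : ℂ))

theorem autFactor_eq_denom (γ : SL(2, ℤ)) (τ : ℍ) : autFactor γ τ = denom γ τ := by
  simp [autFactor, denom]

theorem autFactor_ne_zero (γ : SL(2, ℤ)) (τ : ℍ) : autFactor γ τ ≠ 0 := by
  rw [autFactor_eq_denom]
  exact denom_ne_zero _ τ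

theorem autFactor_mul (γ₁ γ₂ : SL(2, ℤ)) (τ : ℍ) :
    autFactor (γ₁ * γ₂) τ = autFactor γ₁ (γ₂ • τ) * autFactor γ₂ τ := by
  have h : (γ₂ 1 0 : ℂ) * (τ : ℂ) + (γ₂ 1 1 : ℂ) ≠ 0 := autFactor_ne_zero γ₂ τ
  simp only [autFactor, Matrix.SpecialLinearGroup.coe_mul, Matrix.mul_apply, Fin.sum_univ_two,
    specialLinearGroup_apply]
  push_cast
  simp only [algebraMap_int_eq, eq_intCast, Complex.ofReal_intCast]
  field_simp
  ring

theorem continuous_autFactor (γ : SL(2, ℤ)) : Continuous (autFactor γ) := by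
  unfold autFactor
  fun_prop

theorem continuous_rootFactor (D : ℕ) (γ : SL(2, ℤ)) : Continuous (rootFactor D γ) := by
  by_cases hc : γ 1 0 = 0
  · have : rootFactor D γ = fun _ => (γ 1 1 : ℂ) ^ (1 / (D : ℂ)) := by
      funext τ
      simp [rootFactor, autFactor, hc]
    rw [this]
    exact continuous_const
  · refine (continuous_autFactor γ).cpow continuous_const fun τ => Or.inr ?_
    have : (autFactor γ τ).im = (γ 1 0 : ℝ) * τ.im := by
      simp [autFactor]
    rw [this]
    exact mul_ne_zero (by exact_mod_cast hc) τ.im_ne_zero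

theorem rootFactor_pow (D : ℕ) [NeZero D] (γ : SL(2, ℤ)) (τ : ℍ) :
    rootFactor D γ τ ^ D = autFactor γ τ := by
  rw [rootFactor, one_div, Complex.cpow_nat_inv_pow _ (NeZero.ne D)]

theorem rootFactor_ne_zero (D : ℕ) (γ : SL(2, ℤ)) (τ : ℍ) : rootFactor D γ τ ≠ 0 := by
  rw [rootFactor, Complex.cpow_def_of_ne_zero (autFactor_ne_zero γ τ)]
  exact Complex.exp_ne_zero _

/-- A continuous `D`-th root of `c τ + d` is the principal one up to a constant root of unity. -/
theorem exists_eq_mul_rootFactor (D : ℕ) [NeZero D] (γ : SL(2, ℤ)) (φ : ℍ → ℂ) (hφ : Continuous φ)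
    (h : ∀ τ, φ τ ^ D = autFactor γ τ) :
    ∃ ε : ℂ, ε ^ D = 1 ∧ ∀ τ, φ τ = ε * rootFactor D γ τ := by
  have hq : Continuous fun τ => φ τ / rootFactor D γ τ :=
    hφ.div (continuous_rootFactor D γ) (rootFactor_ne_zero D γ)
  have h1 : ∀ τ, (φ τ / rootFactor D γ τ) ^ D = 1 := fun τ => by
    rw [div_pow, h, rootFactor_pow, div_self (autFactor_ne_zero γ τ)]
  have hfin : {z : ℂ | z ^ D = 1}.Finite := by
    refine (Polynomial.nthRoots D (1 : ℂ)).toFinset.finite_toSet.subset fun z hz => ?_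
    simpa [Polynomial.mem_nthRoots (Nat.pos_of_ne_zero (NeZero.ne D))] using hz
  have hconst : ∀ τ, φ τ / rootFactor D γ τ = φ I / rootFactor D γ I := fun τ =>
    isPreconnected_univ.constant_of_mapsTo hfin.isDiscrete hq.continuousOn
      (fun x _ => h1 x) (Set.mem_univ τ) (Set.mem_univ I)
  refine ⟨φ I / rootFactor D γ I, h1 I, fun τ => ?_⟩
  rw [← hconst τ, div_mul_cancel₀ _ (rootFactor_ne_zero D γ τ)]

/-- The `D`-cover of `SL(2, ℤ)`: pairs `(γ, φ)` of a matrix `γ` with bottom row `(c, d)` and a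
function `φ(τ) = ε (c τ + d) ^ (1 / D)` on the upper half plane, where `ε ^ D = 1`. -/
@[ext]
structure DCover (D : ℕ) where
  mat : SL(2, ℤ)
  root : ℍ → ℂ
  root_eq : ∃ ε : ℂ, ε ^ D = 1 ∧ ∀ τ, root τ = ε * rootFactor D mat τ

namespace DCover

variable {D : ℕ}

theorem continuous_root (g : DCover D) : Continuous g.root := by
  obtain ⟨ε, -, h⟩ := g.root_eq
  rw [show g.root = fun τ => ε * rootFactor D g.mat τ from funext h]
  exact continuous_const.mul (continuous_rootFactor D g.mat)

theorem root_pow [NeZero D] (g : DCover D) (τ : ℍ) : g.root τ ^ D = autFactor g.mat τ := by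
  obtain ⟨ε, hε, h⟩ := g.root_eq
  rw [h, mul_pow, hε, one_mul, rootFactor_pow]

theorem root_ne_zero [NeZero D] (g : DCover D) (τ : ℍ) : g.root τ ≠ 0 := fun h => by
  have := g.root_pow τ
  rw [h, zero_pow (NeZero.ne D)] at this
  exact autFactor_ne_zero _ _ this.symm

theorem continuous_smul_uhp (γ : SL(2, ℤ)) : Continuous fun τ : ℍ => γ • τ :=
  continuous_const_smul (γ : GL (Fin 2) ℝ)

/-- `(γ₁, φ₁) (γ₂, φ₂) = (γ₁ γ₂, φ₁(γ₂ τ) φ₂(τ))`. -/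
instance [NeZero D] : Mul (DCover D) where
  mul g h :=
    { mat := g.mat * h.mat
      root := fun τ => g.root (h.mat • τ) * h.root τ
      root_eq := exists_eq_mul_rootFactor D _ _
        ((g.continuous_root.comp (continuous_smul_uhp h.mat)).mul h.continuous_root) fun τ => by
          rw [mul_pow, root_pow, root_pow, autFactor_mul] }

instance [NeZero D] : One (DCover D) where
  one :=
    { mat := 1
      root := fun _ => 1
      root_eq := exists_eq_mul_rootFactor D _ _ continuous_const fun τ => by simp [autFactor] }

instance [NeZero D] : Inv (DCover D) where
  inv g :=
    { mat := g.mat⁻¹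
      root := fun τ => (g.root (g.mat⁻¹ • τ))⁻¹
      root_eq := exists_eq_mul_rootFactor D _ _
        ((g.continuous_root.comp (continuous_smul_uhp g.mat⁻¹)).inv₀ fun τ => g.root_ne_zero _)
        fun τ => by
          have h := autFactor_mul g.mat g.mat⁻¹ τ
          rw [mul_inv_cancel] at h
          rw [inv_pow, root_pow]
          refine inv_eq_of_mul_eq_one_right ?_
          rw [← h]
          simp [autFactor] }

instance [NeZero D] : Group (DCover D) where
  mul_assoc a b c := by
    refine DCover.ext (mul_assoc a.mat b.mat c.mat) (funext fun τ => ?_)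
    change a.root (b.mat • c.mat • τ) * b.root (c.mat • τ) * c.root τ =
      a.root ((b.mat * c.mat) • τ) * (b.root (c.mat • τ) * c.root τ)
    rw [mul_smul, mul_assoc]
  one_mul a := by
    refine DCover.ext (one_mul a.mat) (funext fun τ => ?_)
    change 1 * a.root τ = a.root τ
    rw [one_mul]
  mul_one a := by
    refine DCover.ext (mul_one a.mat) (funext fun τ => ?_)
    change a.root ((1 : SL(2, ℤ)) • τ) * 1 = a.root τ
    rw [one_smul, mul_one]
  inv_mul_cancel a := by
    refine DCover.ext (inv_mul_cancel a.mat) (funext fun τ => ?_)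
    change (a.root (a.mat⁻¹ • a.mat • τ))⁻¹ * a.root τ = 1
    rw [inv_smul_smul, inv_mul_cancel₀ (a.root_ne_zero τ)]

/-- The projection `(γ, φ) ↦ γ`. -/
def proj (D : ℕ) [NeZero D] : DCover D →* SL(2, ℤ) where
  toFun := DCover.mat
  map_one' := rfl
  map_mul' _ _ := rfl

/-- The lift `γ ↦ (γ, (c τ + d) ^ (1 / D))`; it is not a homomorphism in general. -/
def lift (D : ℕ) (γ : SL(2, ℤ)) : DCover D where
  mat := γ
  root := rootFactor D γ
  root_eq := ⟨1, one_pow D, fun _ => (one_mul _).symm⟩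

end DCover

/-- The `D`-cover of a subgroup `G` of `SL(2, ℤ)`: its preimage in the `D`-cover of `SL(2, ℤ)`. -/
def coverOf (D : ℕ) [NeZero D] (G : Subgroup SL(2, ℤ)) : Subgroup (DCover D) :=
  G.comap (DCover.proj D)

/-! ### Meromorphic modular forms of weight `j / D` -/

/-- The slash operator of weight `k = j / D`:
`(f ∣ (γ, φ))(τ) = φ(τ) ^ (-j) f(γ τ)`, where `j = D k`. -/
def slash {D : ℕ} (j : ℤ) (f : ℍ → ℂ) (g : DCover D) (τ : ℍ) : ℂ :=
  g.root τ ^ (-j) * f (g.mat • τ)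

/-- `f` is a meromorphic function on the upper half plane. An element of the field of meromorphic
functions is represented by its unique representative in normal form, that is, the one that is
analytic outside its poles and takes the default value `0` at each pole. -/
def IsMeromorphicOnUHP (f : ℍ → ℂ) : Prop :=
  MeromorphicNFOn (f ∘ ofComplex) {z : ℂ | 0 < z.im}

/-- `ord_{i∞} f = r`: on some half plane `Im τ > Y`, `f` is the sum of a convergent series of terms
`c_n q ^ (r + n / w)` (`n = 0, 1, 2, …`) with `c_0 ≠ 0`, where `q ^ x = exp (2 π i x τ)`. -/
def HasOrderAtInfty (f : ℍ → ℂ) (r : ℝ) : Prop :=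
  ∃ w : ℕ, 0 < w ∧ ∃ c : ℕ → ℂ, c 0 ≠ 0 ∧ ∃ Y : ℝ, 0 < Y ∧ ∀ τ : ℍ, Y < τ.im →
    HasSum (fun n : ℕ => c n * Complex.exp (2 * Real.pi * Complex.I * (r + n / w) * τ)) (f τ)

/-- `f` is a meromorphic modular form of weight `j / D` for `G` with character `χ`. The last
condition says that `ord_{i∞}(f ∣ g) > -∞` for all `g` in the `D`-cover of `SL(2, ℤ)`; the order of
the zero function is `+∞`. -/
structure IsMeromorphicModularForm (D : ℕ) [NeZero D] (j : ℤ) (G : Subgroup SL(2, ℤ))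
    (χ : coverOf D G →* Circle) (f : ℍ → ℂ) : Prop where
  meromorphic : IsMeromorphicOnUHP f
  slash_eq : ∀ (g : coverOf D G) (τ : ℍ), slash j f (g : DCover D) τ = (χ g : ℂ) * f τ
  meromorphic_at_cusps : ∀ g : DCover D,
    (∀ τ, slash j f g τ = 0) ∨ ∃ r : ℝ, HasOrderAtInfty (slash j f g) r

/-! ### The modular curve and divisors -/

/-- `SL(2, ℤ)` acts on `ℙ¹(ℚ) = ℚ ∪ {∞}` by Möbius transformations. -/
instance : MulAction SL(2, ℤ) (OnePoint ℚ) :=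
  MulAction.compHom _ (Matrix.SpecialLinearGroup.mapGL (R := ℤ) ℚ)

/-- The extended upper half plane, the disjoint union of the upper half plane and `ℙ¹(ℚ)`. -/
abbrev ExtUHP : Type := ℍ ⊕ OnePoint ℚ

/-- The set of points of the modular curve `X_G`: the orbits of `G` on the extended upper half
plane. -/
abbrev ModularCurve (G : Subgroup SL(2, ℤ)) : Type := MulAction.orbitRel.Quotient G ExtUHP

/-- The point `G x` of the modular curve. -/
def ModularCurve.mk (G : Subgroup SL(2, ℤ)) (x : ExtUHP) : ModularCurve G :=
  Quotient.mk (MulAction.orbitRel G ExtUHP) x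

/-- The image of a subgroup in `SL(2, ℤ) / {±I}`; the centre of `SL(2, ℤ)` is `{±I}`. -/
def bar (H : Subgroup SL(2, ℤ)) : Subgroup (SL(2, ℤ) ⧸ Subgroup.center SL(2, ℤ)) :=
  H.map (QuotientGroup.mk' (Subgroup.center SL(2, ℤ)))

/-- The stabilizer of `x` in the image of `G` in `SL(2, ℤ) / {±I}`. -/
def barStabilizer (G : Subgroup SL(2, ℤ)) (x : ExtUHP) :
    Subgroup (SL(2, ℤ) ⧸ Subgroup.center SL(2, ℤ)) :=
  bar (G ⊓ MulAction.stabilizer SL(2, ℤ) x)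

/-- The width of a cusp `x`: the index of the stabilizer of `x` in the image of `G` in the stabilizer
of `x` in `SL(2, ℤ) / {±I}`. -/
def width (G : Subgroup SL(2, ℤ)) (x : OnePoint ℚ) : ℕ :=
  (barStabilizer G (Sum.inr x)).relIndex (barStabilizer ⊤ (Sum.inr x))

/-- `d` is the divisor of the nonzero meromorphic modular form `f` of weight `j / D` for `G`: its
value at `G τ` is the order of `f` at `τ`, divided by the order of the stabilizer of `τ` in the image
of `G` in `SL(2, ℤ) / {±I}`, and its value at the cusp `G x`, where `x = γ(i∞)`, is the order at `i∞`
of `f ∣ γ̃`, times the width of the cusp. -/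
structure IsDivisorOf (D : ℕ) (j : ℤ) (G : Subgroup SL(2, ℤ)) (f : ℍ → ℂ)
    (d : ModularCurve G → ℝ) : Prop where
  at_point : ∀ τ : ℍ, ∃ n : ℤ, meromorphicOrderAt (f ∘ ofComplex) (τ : ℂ) = n ∧
    d (ModularCurve.mk G (Sum.inl τ)) = n / Nat.card (barStabilizer G (Sum.inl τ))
  at_cusp : ∀ γ : SL(2, ℤ), ∃ r : ℝ, HasOrderAtInfty (slash j f (DCover.lift D γ)) r ∧
    d (ModularCurve.mk G (Sum.inr (γ • (∞ : OnePoint ℚ)))) =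
      r * width G (γ • (∞ : OnePoint ℚ))

/-- The degree of a divisor. -/
def degree {X : Type*} (d : X →₀ ℝ) : ℝ := d.sum fun _ a => a

end

end RationalWeight

namespace RationalWeight

noncomputable section

open Filter Topology

/-! ### Leading exponents at `i∞` -/

/-! Everything is reduced to weight zero and level one. The function `weightZero D j f`, that is `f
^ (12 D) / Δ ^ j`, has weight zero: the `D`-th roots in the automorphy factor and their roots of
unity disappear in the power `12 D`. Under `±G` it is multiplied by constants, and its orders are
`12 D ord f` on the upper half plane, where `Δ` has no zeros, and `12 D r - j` at a cusp where `f`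
has order `r`. The product of its translates over the cosets of `±G` is multiplied by constants
under all of `SL(2, ℤ)` (`exists_prod_weightZero_smul`). That `χ` may have infinite order is
harmless, because characters of `SL(2, ℤ)` have order dividing 12: the twelfth power of the product
is invariant (`pow_twelve_smul`).

In level one (`sum_ord_div_card_add_exponent`) zeros and poles are removed by powers of `j - j(τ)`.
This function vanishes only on the orbit of `τ` (`exists_smul_eq_of_jInv_eq`), to an order equal to
that of the stabilizer (`ordAt_jInv_sub`), and has a simple pole at `i∞`. An invariant function
without zeros and poles on the upper half plane has exponent zero at `i∞`, since otherwise it or its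
inverse would be a nonzero cusp form of weight zero (`exponent_eq_zero_of_invariant`). Comparing
exponents gives degree zero. No contour integral is used.

To return to `X_G`, the cosets sending a point `z` to a given point of `X_G` are counted by orbit
and stabilizer (`ncard_coset_fiber`). The same index is the width at a cusp and the ratio of
stabilizer orders at an interior point, so the sum over cosets is the degree (`sum_eq_sum_cosets`).
The terms `-j`, one for each coset, add up to the right side of the formula.

At `i∞` only the leading exponent of an expansion matters. `HasExponent` records it and, unlike the
expansion with its denominator `w`, passes easily to products, inverses and translates. -/

/-- `f` is asymptotic to a nonzero multiple of `q ^ r` at `i∞`. -/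
def HasExponent (f : ℍ → ℂ) (r : ℝ) : Prop :=
  ∃ c : ℂ, c ≠ 0 ∧
    Tendsto (fun τ : ℍ => f τ * Complex.exp (-(2 * Real.pi * Complex.I * r * τ))) atImInfty (𝓝 c)

theorem tendsto_im_atImInfty : Tendsto UpperHalfPlane.im atImInfty atTop := tendsto_comap

/-- Multiplication by `q ^ (-r)` leaves a power series in `Q = exp (2 π i τ / w)`. Its convergence
at the single point `i (Y + 1)` dominates it on all of `Im τ ≥ Y + 1`, so the limit can be taken
term by term. -/
theorem tendsto_mul_exp_of_hasSum {f : ℍ → ℂ} {r : ℝ} {w : ℕ} (hw : 0 < w) {c : ℕ → ℂ} {Y : ℝ}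
    (hY : 0 < Y) (hs : ∀ τ : ℍ, Y < τ.im →
      HasSum (fun n : ℕ => c n * Complex.exp (2 * Real.pi * Complex.I * (r + n / w) * τ)) (f τ)) :
    Tendsto (fun τ : ℍ => f τ * Complex.exp (-(2 * Real.pi * Complex.I * r * τ))) atImInfty
      (𝓝 (c 0)) := by
  have hwR : (0 : ℝ) < w := by exact_mod_cast hw
  have hwC : (w : ℂ) ≠ 0 := by exact_mod_cast hw.ne'
  set Q : ℍ → ℂ := fun τ => Complex.exp (2 * Real.pi * Complex.I * τ / w) with hQ
  have hnorm : ∀ τ : ℍ, ‖Q τ‖ = Real.exp (-(2 * Real.pi / w) * τ.im) := fun τ => by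
    rw [hQ, Complex.norm_exp]
    congr 1
    rw [show (2 * Real.pi * Complex.I * τ / w : ℂ) =
      ((2 * Real.pi / w : ℝ) : ℂ) * (Complex.I * τ) by push_cast; ring, Complex.re_ofReal_mul]
    simp
  have hser : ∀ τ : ℍ, Y < τ.im → HasSum (fun n : ℕ => c n * Q τ ^ n)
      (f τ * Complex.exp (-(2 * Real.pi * Complex.I * r * τ))) := fun τ hτ => by
    refine ((hs τ hτ).mul_right (Complex.exp (-(2 * Real.pi * Complex.I * r * τ)))).congr_fun ?_
    intro n
    rw [hQ, ← Complex.exp_nat_mul, mul_assoc (c n), ← Complex.exp_add]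
    congr 2
    field_simp
    ring
  let τ₀ : ℍ := ⟨Complex.I * (Y + 1 : ℝ), by simp; linarith⟩
  have hτ₀ : τ₀.im = Y + 1 := by simp [τ₀, UpperHalfPlane.im]
  have hsum : Summable fun n : ℕ => ‖c n‖ * ‖Q τ₀‖ ^ n := by
    have := (hser τ₀ (by rw [hτ₀]; linarith)).summable.norm
    simpa using this
  have hlim : Tendsto (fun τ : ℍ => ∑' n : ℕ, c n * Q τ ^ n) atImInfty
      (𝓝 (∑' n : ℕ, if n = 0 then c 0 else 0)) := by
    refine tendsto_tsum_of_dominated_convergence hsum (fun n => ?_) ?_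
    · have hQ0 : Tendsto Q atImInfty (𝓝 0) := by
        rw [tendsto_zero_iff_norm_tendsto_zero]
        simp_rw [hnorm]
        refine Real.tendsto_exp_atBot.comp ?_
        exact tendsto_im_atImInfty.const_mul_atTop_of_neg (by
          have := Real.pi_pos
          have : 0 < 2 * Real.pi / w := by positivity
          linarith)
      rcases Nat.eq_zero_or_pos n with rfl | hn
      · simp
      · have := (hQ0.pow n).const_mul (c n)
        simpa [hn.ne'] using this
    · filter_upwards [tendsto_im_atImInfty.eventually_ge_atTop (Y + 1)] with τ hτ n
      rw [norm_mul, norm_pow]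
      gcongr ‖c n‖ * ?_ ^ n
      rw [hnorm, hnorm, hτ₀, Real.exp_le_exp]
      have := Real.pi_pos
      have : 0 < 2 * Real.pi / w := by positivity
      nlinarith
  rw [tsum_ite_eq] at hlim
  refine hlim.congr' ?_
  filter_upwards [tendsto_im_atImInfty.eventually_gt_atTop Y] with τ hτ
  exact (hser τ hτ).tsum_eq

theorem HasOrderAtInfty.hasExponent {f : ℍ → ℂ} {r : ℝ} (h : HasOrderAtInfty f r) :
    HasExponent f r := by
  obtain ⟨w, hw, c, hc, Y, hY, hs⟩ := h
  exact ⟨c 0, hc, tendsto_mul_exp_of_hasSum hw hY hs⟩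

namespace HasExponent

variable {f g : ℍ → ℂ} {r s : ℝ}

theorem mul (hf : HasExponent f r) (hg : HasExponent g s) :
    HasExponent (fun τ => f τ * g τ) (r + s) := by
  obtain ⟨c, hc, h⟩ := hf
  obtain ⟨d, hd, h'⟩ := hg
  refine ⟨c * d, mul_ne_zero hc hd, (h.mul h').congr fun τ => ?_⟩
  rw [mul_mul_mul_comm, ← Complex.exp_add]
  congr 2
  push_cast
  ring

theorem const {c : ℂ} (hc : c ≠ 0) : HasExponent (fun _ => c) 0 :=
  ⟨c, hc, by simp⟩

theorem const_mul {c : ℂ} (hc : c ≠ 0) (hf : HasExponent f r) :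
    HasExponent (fun τ => c * f τ) r := by
  simpa using (const hc).mul hf

theorem inv (hf : HasExponent f r) : HasExponent (fun τ => (f τ)⁻¹) (-r) := by
  obtain ⟨c, hc, h⟩ := hf
  refine ⟨c⁻¹, inv_ne_zero hc, (h.inv₀ hc).congr fun τ => ?_⟩
  rw [mul_inv, ← Complex.exp_neg]
  congr 2
  push_cast
  ring

theorem pow (hf : HasExponent f r) (n : ℕ) : HasExponent (fun τ => f τ ^ n) (n * r) := by
  induction n with
  | zero => simpa using const one_ne_zero
  | succ n ih =>
    simp_rw [pow_succ]
    convert ih.mul hf using 1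
    push_cast
    ring

theorem zpow (hf : HasExponent f r) (n : ℤ) : HasExponent (fun τ => f τ ^ n) (n * r) := by
  obtain ⟨m, rfl | rfl⟩ := n.eq_nat_or_neg
  · simpa using hf.pow m
  · simpa using (hf.pow m).inv

theorem prod {ι : Type*} (t : Finset ι) {F : ι → ℍ → ℂ} {R : ι → ℝ}
    (h : ∀ i ∈ t, HasExponent (F i) (R i)) :
    HasExponent (fun τ => ∏ i ∈ t, F i τ) (∑ i ∈ t, R i) := by
  classical
  induction t using Finset.induction_on with
  | empty => simpa using const one_ne_zero
  | insert a t ha ih =>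
    simp_rw [Finset.prod_insert ha, Finset.sum_insert ha]
    exact (h a (by simp)).mul (ih fun i hi => h i (by simp [hi]))

theorem congr' (hf : HasExponent f r) (h : f =ᶠ[atImInfty] g) : HasExponent g r := by
  obtain ⟨c, hc, hl⟩ := hf
  refine ⟨c, hc, hl.congr' ?_⟩
  filter_upwards [h] with τ hτ
  rw [hτ]

theorem norm_exp (r : ℝ) (τ : ℍ) :
    ‖Complex.exp (-(2 * Real.pi * Complex.I * r * τ))‖ = Real.exp (2 * Real.pi * r * τ.im) := by
  rw [Complex.norm_exp]
  congr 1
  rw [show (-(2 * Real.pi * Complex.I * r * τ) : ℂ) =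
    ((-(2 * Real.pi * r) : ℝ) : ℂ) * (Complex.I * τ) by push_cast; ring, Complex.re_ofReal_mul]
  simp

/-- A function with a negative exponent does not stay bounded along any sequence going to `i∞`. -/
theorem nonneg_of_frequently_norm_le (hf : HasExponent f r) {M : ℝ}
    (hM : ∃ᶠ τ in atImInfty, ‖f τ‖ ≤ M) : 0 ≤ r := by
  obtain ⟨c, hc, h⟩ := hf
  by_contra! hr
  have h1 : Tendsto (fun τ : ℍ => M * Real.exp (2 * Real.pi * r * τ.im)) atImInfty (𝓝 (M * 0)) := by
    refine (Real.tendsto_exp_atBot.comp ?_).const_mul M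
    refine tendsto_im_atImInfty.const_mul_atTop_of_neg ?_
    have := Real.pi_pos
    nlinarith [mul_pos this (neg_pos.2 hr)]
  rw [mul_zero] at h1
  have h2 := h.norm
  have hc' : 0 < ‖c‖ := norm_pos_iff.2 hc
  have h3 : ∀ᶠ τ : ℍ in atImInfty, ¬ ‖f τ‖ ≤ M := by
    filter_upwards [h1.eventually_lt_const (half_pos hc'),
      h2.eventually_const_lt (half_lt_self hc')] with τ hτ1 hτ2 hle
    rw [norm_mul, norm_exp] at hτ2
    have := mul_le_mul_of_nonneg_right hle (Real.exp_pos (2 * Real.pi * r * τ.im)).le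
    linarith
  exact hM h3

theorem eventually_ne_zero (hf : HasExponent f r) : ∀ᶠ τ in atImInfty, f τ ≠ 0 := by
  obtain ⟨c, hc, h⟩ := hf
  filter_upwards [h.eventually_ne hc] with τ hτ h0
  simp [h0] at hτ

/-- The quotient `f / f` has exponent `r - s` and is eventually 1, hence bounded, so `r - s` is not
negative; by symmetry neither is `s - r`. -/
theorem unique (hf : HasExponent f r) (hf' : HasExponent f s) : r = s := by
  have key : ∀ {r s : ℝ}, HasExponent f r → HasExponent f s → 0 ≤ r - s := fun {r s} h h' => by
    have h1 := h.mul h'.inv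
    refine h1.nonneg_of_frequently_norm_le (M := 1) (Eventually.frequently ?_)
    filter_upwards [h.eventually_ne_zero] with τ hτ
    rw [mul_inv_cancel₀ hτ, norm_one]
  have := key hf hf'
  have := key hf' hf
  linarith

/-- Near `i∞` a function with exponent `r` is bounded above and below by multiples of `|q ^ r|`. -/
theorem exists_bounds (hf : HasExponent f r) : ∃ A a b : ℝ, 0 < a ∧ ∀ τ : ℍ, A ≤ τ.im →
    a * Real.exp (-(2 * Real.pi * r * τ.im)) ≤ ‖f τ‖ ∧
      ‖f τ‖ ≤ b * Real.exp (-(2 * Real.pi * r * τ.im)) := by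
  obtain ⟨c, hc, h⟩ := hf
  have hc' : 0 < ‖c‖ := norm_pos_iff.2 hc
  obtain ⟨A, hA⟩ := (atImInfty_mem _).1 ((h.norm.eventually_lt_const (lt_add_one ‖c‖)).and
    (h.norm.eventually_const_lt (half_lt_self hc')))
  refine ⟨A, ‖c‖ / 2, ‖c‖ + 1, half_pos hc', fun τ hτ => ?_⟩
  have := hA τ hτ
  simp only [Set.mem_ofPred_eq, norm_mul, norm_exp] at this
  rw [Real.exp_neg, ← div_eq_mul_inv, ← div_eq_mul_inv, div_le_iff₀ (Real.exp_pos _),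
    le_div_iff₀ (Real.exp_pos _)]
  exact ⟨this.2.le, this.1.le⟩

theorem tendsto_vadd_atImInfty (x : ℝ) :
    Tendsto (fun τ : ℍ => x +ᵥ τ) atImInfty atImInfty := by
  rw [atImInfty, tendsto_comap_iff]
  refine tendsto_comap.congr fun τ => ?_
  simp

theorem vadd (hf : HasExponent f r) (x : ℝ) : HasExponent (fun τ => f (x +ᵥ τ)) r := by
  obtain ⟨c, hc, h⟩ := hf
  refine ⟨c * Complex.exp (2 * Real.pi * Complex.I * r * x),
    mul_ne_zero hc (Complex.exp_ne_zero _), ?_⟩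
  refine ((h.comp (tendsto_vadd_atImInfty x)).mul_const _).congr fun τ => ?_
  simp only [Function.comp_apply, mul_assoc, ← Complex.exp_add, coe_vadd]
  congr 2
  ring

/-- A quasi-period of `f` determines its exponent modulo integers. -/
theorem exp_eq_of_vadd (hf : HasExponent f r) (x : ℝ) {ζ : ℂ} (h : ∀ τ, f (x +ᵥ τ) = ζ * f τ) :
    Complex.exp (2 * Real.pi * Complex.I * r * x) = ζ := by
  obtain ⟨c, hc, hl⟩ := hf
  have h1 := (hl.comp (tendsto_vadd_atImInfty x)).mul_const
    (Complex.exp (2 * Real.pi * Complex.I * r * x))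
  have h2 := hl.const_mul ζ
  have h3 := tendsto_nhds_unique h1 (h2.congr fun τ => ?_)
  · rw [mul_comm] at h3
    exact mul_right_cancel₀ hc h3
  · simp only [Function.comp_apply, mul_assoc, ← Complex.exp_add, coe_vadd, h]
    congr 3
    ring

end HasExponent

/-! ### Meromorphic functions on the upper half plane -/

/-- `f` is meromorphic on the upper half plane. -/
def IsMero (f : ℍ → ℂ) : Prop := ∀ τ : ℍ, MeromorphicAt (f ∘ ofComplex) (τ : ℂ)

/-- The order of `f` at `τ`. -/
def ordAt (f : ℍ → ℂ) (τ : ℍ) : WithTop ℤ := meromorphicOrderAt (f ∘ ofComplex) (τ : ℂ)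

theorem IsMeromorphicOnUHP.isMero {f : ℍ → ℂ} (h : IsMeromorphicOnUHP f) : IsMero f :=
  fun τ => h.meromorphicOn τ τ.im_pos

theorem isMero_iff {f : ℍ → ℂ} :
    IsMero f ↔ MeromorphicOn (f ∘ ofComplex) {z : ℂ | 0 < z.im} :=
  ⟨fun h z hz => h ⟨z, hz⟩, fun h τ => h τ τ.im_pos⟩

namespace IsMero

variable {f g : ℍ → ℂ}

theorem mul (hf : IsMero f) (hg : IsMero g) : IsMero (fun τ => f τ * g τ) :=
  fun τ => (hf τ).mul (hg τ)

theorem zpow (hf : IsMero f) (n : ℤ) : IsMero (fun τ => f τ ^ n) :=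
  fun τ => (hf τ).zpow n

theorem pow (hf : IsMero f) (n : ℕ) : IsMero (fun τ => f τ ^ n) :=
  fun τ => (hf τ).pow n

theorem prod {ι : Type*} (t : Finset ι) {F : ι → ℍ → ℂ} (h : ∀ i ∈ t, IsMero (F i)) :
    IsMero (fun τ => ∏ i ∈ t, F i τ) := by
  classical
  induction t using Finset.induction_on with
  | empty => exact fun τ => MeromorphicAt.const (1 : ℂ) (τ : ℂ)
  | insert a t ha ih =>
    simp_rw [Finset.prod_insert ha]
    exact (h a (by simp)).mul (ih fun i hi => h i (by simp [hi]))

end IsMero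

theorem ordAt_mul {f g : ℍ → ℂ} (hf : IsMero f) (hg : IsMero g) (τ : ℍ) :
    ordAt (fun τ => f τ * g τ) τ = ordAt f τ + ordAt g τ :=
  meromorphicOrderAt_mul (hf τ) (hg τ)

theorem ordAt_zpow {f : ℍ → ℂ} (hf : IsMero f) (n : ℤ) (τ : ℍ) :
    ordAt (fun τ => f τ ^ n) τ = n * ordAt f τ :=
  meromorphicOrderAt_zpow (hf τ)

theorem ordAt_pow {f : ℍ → ℂ} (hf : IsMero f) (n : ℕ) (τ : ℍ) :
    ordAt (fun τ => f τ ^ n) τ = n * ordAt f τ :=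
  meromorphicOrderAt_pow (hf τ)

theorem ordAt_const {c : ℂ} (hc : c ≠ 0) (τ : ℍ) : ordAt (fun _ => c) τ = 0 := by
  classical
  simpa [hc] using! meromorphicOrderAt_const (τ : ℂ) c

theorem isMero_const (c : ℂ) : IsMero fun _ => c := fun τ => MeromorphicAt.const c (τ : ℂ)

theorem ordAt_const_mul {f : ℍ → ℂ} (hf : IsMero f) {c : ℂ} (hc : c ≠ 0) (τ : ℍ) :
    ordAt (fun τ => c * f τ) τ = ordAt f τ := by
  rw [ordAt_mul (isMero_const c) hf, ordAt_const hc, zero_add]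

theorem ordAt_prod {ι : Type*} (t : Finset ι) {F : ι → ℍ → ℂ} (h : ∀ i ∈ t, IsMero (F i)) (τ : ℍ) :
    ordAt (fun τ => ∏ i ∈ t, F i τ) τ = ∑ i ∈ t, ordAt (F i) τ := by
  classical
  induction t using Finset.induction_on with
  | empty => simpa using ordAt_const one_ne_zero τ
  | insert a t ha ih =>
    simp_rw [Finset.prod_insert ha, Finset.sum_insert ha]
    rw [ordAt_mul (h a (by simp)) (IsMero.prod t fun i hi => h i (by simp [hi])),
      ih fun i hi => h i (by simp [hi])]

theorem comp_smul_eq (f : ℍ → ℂ) (γ : SL(2, ℤ)) :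
    (fun τ => f (γ • τ)) ∘ ofComplex =
      (f ∘ ofComplex) ∘ fun w : ℂ => ((γ • ofComplex w : ℍ) : ℂ) := by
  funext w
  simp [ofComplex_apply]

theorem hasDerivAt_smul (γ : SL(2, ℤ)) (τ : ℍ) :
    HasDerivAt (fun w : ℂ => ((γ • ofComplex w : ℍ) : ℂ)) (1 / denom γ τ ^ 2) (τ : ℂ) := by
  have hdet : (γ : GL (Fin 2) ℝ).val.det = 1 := by
    rw [← Matrix.GeneralLinearGroup.val_det_apply]; simp
  have h := (hasStrictDerivAt_smul (g := (γ : GL (Fin 2) ℝ)) (by rw [hdet]; exact one_pos)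
    τ).hasDerivAt
  rw [hdet, Complex.ofReal_one] at h
  exact h

theorem analyticAt_smul (γ : SL(2, ℤ)) (τ : ℍ) :
    AnalyticAt ℂ (fun w : ℂ => ((γ • ofComplex w : ℍ) : ℂ)) (τ : ℂ) := by
  have hd : DifferentiableOn ℂ (fun w : ℂ => ((γ • ofComplex w : ℍ) : ℂ)) {z | 0 < z.im} :=
    fun z hz => (hasDerivAt_smul γ ⟨z, hz⟩).differentiableAt.differentiableWithinAt
  exact hd.analyticAt (isOpen_upperHalfPlaneSet.mem_nhds τ.im_pos)

theorem IsMero.comp_smul {f : ℍ → ℂ} (hf : IsMero f) (γ : SL(2, ℤ)) :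
    IsMero fun τ => f (γ • τ) := fun τ => by
  rw [comp_smul_eq]
  refine MeromorphicAt.comp_analyticAt ?_ (analyticAt_smul γ τ)
  simpa [ofComplex_apply] using! hf (γ • τ)

theorem ordAt_comp_smul (f : ℍ → ℂ) (γ : SL(2, ℤ)) (τ : ℍ) :
    ordAt (fun τ => f (γ • τ)) τ = ordAt f (γ • τ) := by
  rw [ordAt, comp_smul_eq, meromorphicOrderAt_comp_of_deriv_ne_zero (analyticAt_smul γ τ)]
  · simp [ordAt, ofComplex_apply]
  · rw [(hasDerivAt_smul γ τ).deriv]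
    exact one_div_ne_zero (pow_ne_zero _ (denom_ne_zero _ τ))

theorem ordAt_smul_of_eq_const_mul {f : ℍ → ℂ} (hf : IsMero f) {γ : SL(2, ℤ)} {c : ℂ} (hc : c ≠ 0)
    (h : ∀ τ, f (γ • τ) = c * f τ) (τ : ℍ) : ordAt f (γ • τ) = ordAt f τ := by
  rw [← ordAt_comp_smul, funext h, ordAt_const_mul hf hc]

theorem nhdsNE_eventually_iff {p : ℂ → Prop} {τ : ℍ} :
    (∀ᶠ z in 𝓝[≠] (τ : ℂ), p z) ↔ ∀ᶠ σ : ℍ in 𝓝[≠] τ, p (σ : ℂ) := by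
  have h := isOpenEmbedding_coe.map_nhds_eq τ
  rw [eventually_nhdsWithin_iff, eventually_nhdsWithin_iff, ← h, eventually_map]
  simp

/-- The exponent makes `f` nonzero high up, and the identity theorem on the connected half plane
carries this to every point. -/
theorem ordAt_ne_top {f : ℍ → ℂ} {r : ℝ} (hf : IsMero f) (h : HasExponent f r) (τ : ℍ) :
    ordAt f τ ≠ ⊤ := by
  obtain ⟨A, hA⟩ := (atImInfty_mem _).1 h.eventually_ne_zero
  let σ : ℍ := ⟨Complex.I * (max A 0 + 1 : ℝ), by simp; positivity⟩
  have hσ : A < σ.im := by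
    have : σ.im = max A 0 + 1 := by simp [σ, UpperHalfPlane.im]
    rw [this]
    linarith [le_max_left A 0]
  refine MeromorphicOn.meromorphicOrderAt_ne_top_of_isPreconnected (U := {z : ℂ | 0 < z.im})
    (x := (σ : ℂ)) (isMero_iff.1 hf) (convex_halfSpace_im_gt 0).isPreconnected σ.im_pos τ.im_pos ?_
  rw [meromorphicOrderAt_ne_top_iff_eventually_ne_zero (hf σ), nhdsNE_eventually_iff]
  refine eventually_nhdsWithin_of_eventually_nhds ?_
  filter_upwards [UpperHalfPlane.continuous_im.continuousAt.eventually_const_lt hσ] with z hz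
  simpa using hA z hz.le

/-- High up, `f` lies between two multiples of `|q ^ r|`: the upper bound excludes poles and the
lower bound excludes zeros. -/
theorem exists_ordAt_eq_zero {f : ℍ → ℂ} {r : ℝ} (h : HasExponent f r) :
    ∃ A : ℝ, ∀ τ : ℍ, A < τ.im → ordAt f τ = 0 := by
  obtain ⟨A, a, b, ha, hb⟩ := h.exists_bounds
  refine ⟨A, fun τ hτ => ?_⟩
  have hev : ∀ᶠ σ : ℍ in 𝓝[≠] τ, A ≤ σ.im :=
    eventually_nhdsWithin_of_eventually_nhds
      ((UpperHalfPlane.continuous_im.continuousAt.eventually_const_lt hτ).mono fun _ h => h.le)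
  have hE : Tendsto (fun z : ℂ => Real.exp (-(2 * Real.pi * r * z.im))) (𝓝[≠] (τ : ℂ))
      (𝓝 (Real.exp (-(2 * Real.pi * r * (τ : ℂ).im)))) := by
    refine Tendsto.mono_left ?_ nhdsWithin_le_nhds
    exact Continuous.tendsto (by fun_prop) _
  have hpos := Real.exp_pos (-(2 * Real.pi * r * (τ : ℂ).im))
  have hbd : ∀ᶠ z in 𝓝[≠] (τ : ℂ),
      a * Real.exp (-(2 * Real.pi * r * z.im)) ≤ ‖(f ∘ ofComplex) z‖ ∧
      ‖(f ∘ ofComplex) z‖ ≤ b * Real.exp (-(2 * Real.pi * r * z.im)) := by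
    rw [nhdsNE_eventually_iff]
    filter_upwards [hev] with σ hσ
    simpa [ofComplex_apply] using hb σ hσ
  rcases lt_trichotomy (ordAt f τ) 0 with hneg | h0 | hp
  · exfalso
    have ht := tendsto_norm_cobounded_atTop.comp (tendsto_cobounded_of_meromorphicOrderAt_neg hneg)
    have := (hE.const_mul b).eventually_lt_const (lt_add_one _)
    obtain ⟨z, h1, h2, h3⟩ := (hbd.and (this.and (ht.eventually_gt_atTop _))).exists
    exact absurd (h1.2.trans h2.le) (not_le.2 h3)
  · exact h0
  · exfalso
    have ht := (tendsto_zero_of_meromorphicOrderAt_pos hp).norm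
    rw [norm_zero] at ht
    have := le_of_tendsto_of_tendsto (hE.const_mul a) ht (hbd.mono fun z hz => hz.1)
    have := mul_pos ha hpos
    linarith

end

end RationalWeight

namespace RationalWeight

noncomputable section

open Filter Topology ModularForm EisensteinSeries
open Derivative (normalizedDerivOfComplex serreDerivative serreDerivative_mdifferentiable
  serreDerivative_slash_invariant serreDerivative_apply normalizedDerivOfComplex_mul
  normalizedDerivOfComplex_pow)
open scoped Manifold

/-! ### Level one Eisenstein series and their derivatives -/

theorem tendsto_of_hasSum_qParam {f : ℍ → ℂ} {c : ℕ → ℂ}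
    (h : ∀ τ : ℍ, HasSum (fun m : ℕ => c m * Complex.exp (2 * Real.pi * Complex.I * τ) ^ m) (f τ)) :
    Tendsto f atImInfty (𝓝 (c 0)) := by
  have := tendsto_mul_exp_of_hasSum (f := f) (r := 0) (w := 1) one_pos (c := c) one_pos
    fun τ _ => by
      refine (h τ).congr_fun fun n => ?_
      rw [← Complex.exp_nat_mul]
      congr 2
      push_cast
      ring
  simpa using this

theorem tendsto_E {k : ℕ} (hk : 3 ≤ k) (hk2 : Even k) :
    Tendsto (E hk) atImInfty (𝓝 1) := by
  rw [← E_qExpansion_coeff_zero hk hk2]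
  refine tendsto_of_hasSum_qParam (c := fun m => (qExpansion 1 (E hk)).coeff m) fun τ => ?_
  simpa [Function.Periodic.qParam] using
    ModularForm.hasSum_qExpansion (E hk) one_pos one_mem_strictPeriods_SL τ

theorem tendsto_E2 : Tendsto E2 atImInfty (𝓝 1) := by
  have := tendsto_of_hasSum_qParam (f := E2)
    (c := fun m => if m = 0 then 1 else -24 * ArithmeticFunction.sigma 1 m) fun τ => by
      simpa using hasSum_qExpansion_E2 (z := τ)
  simpa using this

/-- Cauchy's estimate on the unit disc around `τ`. The margin 2 keeps the closed disc inside the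
open half plane and in the region where the bound is known. -/
theorem norm_deriv_comp_ofComplex_le {f : ℍ → ℂ} (hf : MDiff f) {a : ℂ} {A ε : ℝ}
    (h : ∀ τ : ℍ, A ≤ τ.im → ‖f τ - a‖ ≤ ε) (τ : ℍ) (hτ : max A 0 + 2 ≤ τ.im) :
    ‖deriv (f ∘ ofComplex) τ‖ ≤ ε := by
  have hd : deriv (f ∘ ofComplex) (τ : ℂ) = deriv (fun z => (f ∘ ofComplex) z - a) (τ : ℂ) := by
    rw [deriv_sub_const]
  have him : ∀ z ∈ Metric.closedBall (τ : ℂ) 1, max A 0 + 1 ≤ z.im := fun z hz => by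
    have h1 := (Complex.abs_im_le_norm (z - τ)).trans (mem_closedBall_iff_norm.1 hz)
    rw [Complex.sub_im, abs_le] at h1
    have : (τ : ℂ).im = τ.im := rfl
    linarith [h1.1]
  have hpos : ∀ z ∈ Metric.closedBall (τ : ℂ) 1, 0 < z.im := fun z hz => by
    linarith [him z hz, le_max_right A 0]
  rw [hd]
  have hdiff : DifferentiableOn ℂ (fun z => (f ∘ ofComplex) z - a) (Metric.closedBall (τ : ℂ) 1) :=
    ((UpperHalfPlane.mdifferentiable_iff.1 hf).mono hpos).sub_const a
  have := Complex.norm_deriv_le_of_forall_mem_sphere_norm_le (C := ε) one_pos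
    (hdiff.diffContOnCl_ball subset_rfl) fun z hz => by
      have hz' := Metric.sphere_subset_closedBall hz
      have := h ⟨z, hpos z hz'⟩ (by
        change A ≤ z.im
        linarith [him z hz', le_max_left A 0])
      simpa [ofComplex_apply_of_im_pos (hpos z hz')] using this
  simpa using this

theorem tendsto_normalizedDeriv {f : ℍ → ℂ} (hf : MDiff f) {a : ℂ}
    (h : Tendsto f atImInfty (𝓝 a)) :
    Tendsto (normalizedDerivOfComplex f) atImInfty (𝓝 0) := by
  have h0 : Tendsto (fun τ : ℍ => deriv (f ∘ ofComplex) τ) atImInfty (𝓝 0) := by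
    rw [Metric.tendsto_nhds]
    intro ε hε
    have h1 := (Metric.tendsto_nhds.1 h) (ε / 2) (half_pos hε)
    obtain ⟨A, hA⟩ := (atImInfty_mem _).1 h1
    filter_upwards [tendsto_im_atImInfty.eventually_ge_atTop (max A 0 + 2)] with τ hτ
    rw [dist_zero_right]
    refine (norm_deriv_comp_ofComplex_le hf (a := a) (fun σ hσ => ?_) τ hτ).trans_lt (half_lt_self hε)
    have := hA σ hσ
    rw [← dist_eq_norm]
    exact le_of_lt this
  have := h0.const_mul ((2 * Real.pi * Complex.I)⁻¹ : ℂ)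
  rw [mul_zero] at this
  exact this

/-- The cusp form with given underlying function. -/
def mkCuspForm {k : ℤ} (F : ℍ → ℂ) (hF : MDiff F) (hs : ∀ γ : SL(2, ℤ), F ∣[k] γ = F)
    (h0 : Tendsto F atImInfty (𝓝 0)) : CuspForm 𝒮ℒ k where
  toFun := F
  slash_action_eq' A hA := by
    obtain ⟨A, rfl⟩ := hA
    exact hs A
  holo' := hF
  zero_at_cusps' hc := by
    rw [Subgroup.IsArithmetic.isCusp_iff_isCusp_SL2Z] at hc
    rw [OnePoint.isZeroAt_iff_forall_SL2Z hc]
    intro γ _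
    rw [hs γ]
    exact h0

/-- There are no cusp forms of level one and weight below 12. Weights 6 and 8 give the derivative
formulas for `E₄` and `E₆`; weight 0 gives the rigidity of invariant functions. -/
theorem eq_zero_of_tendsto_zero {k : ℤ} (hk : k < 12) (F : ℍ → ℂ) (hF : MDiff F)
    (hs : ∀ γ : SL(2, ℤ), F ∣[k] γ = F) (h0 : Tendsto F atImInfty (𝓝 0)) : F = 0 := by
  have h := CuspForm.rank_eq_zero_of_weight_lt_twelve hk
  rw [rank_zero_iff_forall_zero] at h
  have := h (mkCuspForm F hF hs h0)
  exact congrArg (DFunLike.coe) this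

theorem slash_eq_of_form {k : ℤ} (f : ModularForm 𝒮ℒ k) (γ : SL(2, ℤ)) : (f : ℍ → ℂ) ∣[k] γ = f :=
  f.slash_action_eq' _ ⟨γ, rfl⟩

theorem mdiff_E₄ : MDiff (E₄ : ℍ → ℂ) := E₄.holo'

theorem mdiff_E₆ : MDiff (E₆ : ℍ → ℂ) := E₆.holo'

/-- Ramanujan's identity. The Serre derivative transforms with weight 6. At `i∞` the derivative of
`E₄` dies out and `E2 * E₄` tends to 1, so the limit is `-4 / 12`. Adding `E₆ / 3` cancels it and
leaves a cusp form of weight 6. -/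
theorem serreDerivative_E₄ : serreDerivative 4 E₄ = fun τ => -(1 / 3) * E₆ τ := by
  have hm : MDiff (serreDerivative 4 E₄) := serreDerivative_mdifferentiable 4 mdiff_E₄
  have key := eq_zero_of_tendsto_zero (k := 6) (by norm_num)
    (serreDerivative 4 E₄ + (1 / 3 : ℂ) • ⇑E₆) (hm.add (mdiff_E₆.const_smul _)) (fun γ => by
      have h1 := serreDerivative_slash_invariant mdiff_E₄ (slash_eq_of_form E₄ γ)
      rw [SlashAction.add_slash, ModularForm.SL_smul_slash, slash_eq_of_form E₆ γ]
      exact congrArg (· + _) (by simpa only [Int.cast_ofNat, Int.reduceAdd] using h1)) (by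
      have h1 := tendsto_normalizedDeriv mdiff_E₄ (tendsto_E (k := 4) (by norm_num) ⟨2, rfl⟩)
      have h2 := tendsto_E (k := 4) (by norm_num) ⟨2, rfl⟩
      have h3 := tendsto_E (k := 6) (by norm_num) ⟨3, rfl⟩
      have := (h1.sub ((tendsto_E2.const_mul (4 * 12⁻¹)).mul h2)).add (h3.const_mul (1 / 3))
      convert! this using 2
      norm_num)
  funext τ
  have := congrFun key τ
  simp only [Pi.add_apply, Pi.smul_apply, smul_eq_mul, Pi.zero_apply] at this
  linear_combination this

/-- The same argument in weight 8, where the limit at `i∞` is `-6 / 12`. -/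
theorem serreDerivative_E₆ : serreDerivative 6 E₆ = fun τ => -(1 / 2) * E₄ τ ^ 2 := by
  have hm : MDiff (serreDerivative 6 E₆) := serreDerivative_mdifferentiable 6 mdiff_E₆
  have key := eq_zero_of_tendsto_zero (k := 8) (by norm_num)
    (serreDerivative 6 E₆ + (1 / 2 : ℂ) • (⇑E₄ * ⇑E₄))
    (hm.add ((mdiff_E₄.mul mdiff_E₄).const_smul _)) (fun γ => by
      have h1 := serreDerivative_slash_invariant mdiff_E₆ (slash_eq_of_form E₆ γ)
      have h2 := ModularForm.mul_slash_SL2 4 4 γ E₄ E₄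
      norm_num at h2
      rw [SlashAction.add_slash, ModularForm.SL_smul_slash, h2, slash_eq_of_form E₄ γ]
      exact congrArg (· + _) (by simpa only [Int.cast_ofNat, Int.reduceAdd] using h1)) (by
      have h1 := tendsto_normalizedDeriv mdiff_E₆ (tendsto_E (k := 6) (by norm_num) ⟨3, rfl⟩)
      have h2 := tendsto_E (k := 4) (by norm_num) ⟨2, rfl⟩
      have h3 := tendsto_E (k := 6) (by norm_num) ⟨3, rfl⟩
      have := (h1.sub ((tendsto_E2.const_mul (6 * 12⁻¹)).mul h3)).add ((h2.mul h2).const_mul (1 / 2))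
      convert! this using 2
      norm_num)
  funext τ
  have := congrFun key τ
  simp only [Pi.add_apply, Pi.smul_apply, Pi.mul_apply, smul_eq_mul, Pi.zero_apply] at this
  linear_combination this

theorem mdiff_discriminant : MDiff ModularForm.discriminant := CuspForm.discriminant.holo'

/-- This is the logarithmic derivative of `Δ = η ^ 24`, with that of `η` expressed by `E2`. -/
theorem normalizedDeriv_discriminant (τ : ℍ) :
    normalizedDerivOfComplex ModularForm.discriminant τ = E2 τ * ModularForm.discriminant τ := by
  have h1 : (ModularForm.discriminant ∘ ofComplex) =ᶠ[𝓝 (τ : ℂ)] fun z => eta z ^ 24 := by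
    filter_upwards [isOpen_upperHalfPlaneSet.mem_nhds τ.im_pos] with z hz
    simp [ModularForm.discriminant, ofComplex_apply_of_im_pos hz]
  have h2 := logDeriv_eta_eq_E2 τ
  have h3 := eta_ne_zero τ.im_pos
  rw [logDeriv_apply, div_eq_iff h3] at h2
  rw [normalizedDerivOfComplex, h1.deriv_eq,
    deriv_fun_pow (differentiableAt_eta_of_mem_upperHalfPlaneSet τ.im_pos), h2,
    ModularForm.discriminant]
  have := Real.pi_ne_zero
  field_simp
  push_cast
  ring

theorem isMero_of_mdiff {f : ℍ → ℂ} (hf : MDiff f) : IsMero f := fun τ =>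
  ((UpperHalfPlane.mdifferentiable_iff.1 hf).analyticAt
    (isOpen_upperHalfPlaneSet.mem_nhds τ.im_pos)).meromorphicAt

theorem analyticAt_of_mdiff {f : ℍ → ℂ} (hf : MDiff f) (τ : ℍ) :
    AnalyticAt ℂ (f ∘ ofComplex) τ :=
  (UpperHalfPlane.mdifferentiable_iff.1 hf).analyticAt (isOpen_upperHalfPlaneSet.mem_nhds τ.im_pos)

theorem ordAt_eq_zero_of_ne_zero {f : ℍ → ℂ} (hf : MDiff f) {τ : ℍ} (h : f τ ≠ 0) :
    ordAt f τ = 0 := by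
  have ha := analyticAt_of_mdiff hf τ
  rw [ordAt, ha.meromorphicOrderAt_eq, ha.analyticOrderAt_eq_zero.2 (by simpa using h)]
  rfl

theorem ordAt_eq_one {f : ℍ → ℂ} (hf : MDiff f) {τ : ℍ} (h : f τ = 0)
    (hd : normalizedDerivOfComplex f τ ≠ 0) : ordAt f τ = 1 := by
  have ha := analyticAt_of_mdiff hf τ
  rw [ordAt, ha.meromorphicOrderAt_eq, ha.analyticOrderAt_eq_one_of_zero_deriv_ne_zero
    (by simpa using h) (right_ne_zero_of_mul hd)]
  rfl

/-! ### The `j`-invariant and its ramification. -/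

/-- The `j`-invariant. -/
def jInv (τ : ℍ) : ℂ := E₄ τ ^ 3 / ModularForm.discriminant τ

theorem jInv_sub_1728 (τ : ℍ) : jInv τ - 1728 = E₆ τ ^ 2 / ModularForm.discriminant τ := by
  have h := discriminant_ne_zero τ
  rw [jInv]
  field_simp
  linear_combination -1728 * discriminant_eq_E₄_cube_sub_E₆_sq τ

theorem mdiff_jInv : MDiff jInv := by
  rw [UpperHalfPlane.mdifferentiable_iff]
  have h1 := UpperHalfPlane.mdifferentiable_iff.1 mdiff_E₄
  have h2 := UpperHalfPlane.mdifferentiable_iff.1 mdiff_discriminant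
  exact (h1.pow 3).div h2 fun z _ => discriminant_ne_zero _

/-- Differentiate `E₄ ^ 3 = j Δ` and insert the formulas for the derivatives of `E₄` and `Δ`; the
terms with `E2` cancel. -/
theorem normalizedDeriv_jInv (τ : ℍ) :
    normalizedDerivOfComplex jInv τ = -(E₄ τ ^ 2 * E₆ τ) / ModularForm.discriminant τ := by
  have hΔ := discriminant_ne_zero τ
  have h1 : normalizedDerivOfComplex E₄ τ = -(1 / 3) * E₆ τ + 4 * 12⁻¹ * E2 τ * E₄ τ := by
    have := congrFun serreDerivative_E₄ τ
    rw [serreDerivative_apply] at this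
    linear_combination this
  have h2 := normalizedDeriv_discriminant τ
  have h3 : (⇑E₄) ^ 3 = jInv * ModularForm.discriminant := by
    funext σ
    simp only [Pi.pow_apply, Pi.mul_apply, jInv]
    rw [div_mul_cancel₀ _ (discriminant_ne_zero σ)]
  have h4 := congrFun (normalizedDerivOfComplex_mul _ _ mdiff_jInv mdiff_discriminant) τ
  rw [← h3] at h4
  have h5 := congrFun (normalizedDerivOfComplex_pow E₄ 3 mdiff_E₄) τ
  simp only [Pi.add_apply, Pi.mul_apply, Pi.pow_apply, h1, h2] at h4 h5
  rw [h5] at h4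
  rw [eq_div_iff hΔ]
  have h6 := congrFun h3 τ
  simp only [Pi.pow_apply, Pi.mul_apply] at h6
  norm_num at h4
  linear_combination -h4 + E2 τ * h6

theorem mdiff_jInv_sub (c : ℂ) : MDiff fun τ => jInv τ - c :=
  mdiff_jInv.sub mdifferentiable_const

theorem ordAt_discriminant (τ : ℍ) : ordAt ModularForm.discriminant τ = 0 :=
  ordAt_eq_zero_of_ne_zero mdiff_discriminant (discriminant_ne_zero τ)

theorem ordAt_div_discriminant {f : ℍ → ℂ} (hf : MDiff f) (τ : ℍ) (n : ℕ) :
    ordAt (fun τ => f τ ^ n / ModularForm.discriminant τ) τ = n * ordAt f τ := by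
  have h := isMero_of_mdiff mdiff_discriminant
  have := ordAt_mul ((isMero_of_mdiff hf).pow n) (h.zpow (-1)) τ
  rw [ordAt_zpow h, ordAt_discriminant, ordAt_pow (isMero_of_mdiff hf), mul_zero, add_zero] at this
  rw [← this]
  simp [div_eq_mul_inv]

theorem E₆_ne_zero_of_E₄_eq_zero {τ : ℍ} (h : E₄ τ = 0) : E₆ τ ≠ 0 := fun h' => by
  have := discriminant_eq_E₄_cube_sub_E₆_sq τ
  rw [h, h'] at this
  exact discriminant_ne_zero τ (by simpa using this)

/-- Here `j(τ) = 0` and `j = E₄ ^ 3 / Δ`. The zero of `E₄` is simple, because its derivative there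
is `-E₆ / 3`, and `E₄` and `E₆` have no common zero. -/
theorem ordAt_jInv_sub_of_E₄_eq_zero {τ : ℍ} (h : E₄ τ = 0) :
    ordAt (fun σ => jInv σ - jInv τ) τ = 3 := by
  have h1 : (fun σ => jInv σ - jInv τ) = fun σ => E₄ σ ^ 3 / ModularForm.discriminant σ := by
    funext σ
    simp [jInv, h]
  rw [h1, ordAt_div_discriminant mdiff_E₄, ordAt_eq_one mdiff_E₄ h, mul_one]
  · rfl
  · have := congrFun serreDerivative_E₄ τ
    rw [serreDerivative_apply, h, mul_zero, sub_zero] at this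
    rw [this]
    exact mul_ne_zero (by norm_num) (E₆_ne_zero_of_E₄_eq_zero h)

/-- Here `j(τ) = 1728` and `j - 1728 = E₆ ^ 2 / Δ`; the zero of `E₆` is simple, because its
derivative there is `-E₄ ^ 2 / 2`. -/
theorem ordAt_jInv_sub_of_E₆_eq_zero {τ : ℍ} (h : E₆ τ = 0) :
    ordAt (fun σ => jInv σ - jInv τ) τ = 2 := by
  have h1 : (fun σ => jInv σ - jInv τ) = fun σ => E₆ σ ^ 2 / ModularForm.discriminant σ := by
    funext σ
    rw [← jInv_sub_1728]
    have := jInv_sub_1728 τ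
    rw [h] at this
    linear_combination -this
  rw [h1, ordAt_div_discriminant mdiff_E₆, ordAt_eq_one mdiff_E₆ h, mul_one]
  · rfl
  · have := congrFun serreDerivative_E₆ τ
    rw [serreDerivative_apply, h, mul_zero, sub_zero] at this
    rw [this]
    exact mul_ne_zero (by norm_num) (pow_ne_zero _ fun h' => E₆_ne_zero_of_E₄_eq_zero h' h)

theorem ordAt_jInv_sub_of_ne_zero {τ : ℍ} (h₄ : E₄ τ ≠ 0) (h₆ : E₆ τ ≠ 0) :
    ordAt (fun σ => jInv σ - jInv τ) τ = 1 := by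
  refine ordAt_eq_one (mdiff_jInv_sub _) (sub_self _) ?_
  have : normalizedDerivOfComplex (fun σ => jInv σ - jInv τ) τ =
      normalizedDerivOfComplex jInv τ := by
    simp only [normalizedDerivOfComplex]
    congr 1
    exact deriv_sub_const (f := jInv ∘ ofComplex) _
  rw [this, normalizedDeriv_jInv]
  exact div_ne_zero (neg_ne_zero.2 (mul_ne_zero (pow_ne_zero _ h₄) h₆)) (discriminant_ne_zero τ)

end

end RationalWeight

namespace RationalWeight

noncomputable section

open Filter Topology ModularForm EisensteinSeries
open scoped Manifold

/-! ### The `j`-invariant separates orbits -/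

/-- A twelfth root `s` of the quotient of discriminants matches the cubes of `E₄` and the squares of
`E₆`. What remains is a cube root of unity for `E₄` and a sign for `E₆`. -/
theorem exists_scaling_of_jInv_eq {τ σ : ℍ} (h : jInv σ = jInv τ) :
    ∃ t : ℂ, t ≠ 0 ∧ E₄ σ = t ^ 4 * E₄ τ ∧ E₆ σ = t ^ 6 * E₆ τ := by
  have hτ := discriminant_ne_zero τ
  have hσ := discriminant_ne_zero σ
  obtain ⟨s, hs⟩ := IsAlgClosed.exists_pow_nat_eq
    (ModularForm.discriminant σ / ModularForm.discriminant τ) (n := 12) (by norm_num)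
  have hs0 : s ≠ 0 := fun h0 => by
    rw [h0, zero_pow (by norm_num)] at hs
    exact div_ne_zero hσ hτ hs.symm
  rw [eq_div_iff hτ] at hs
  have h4 : E₄ σ ^ 3 = (s ^ 4 * E₄ τ) ^ 3 := by
    have h1 := h
    rw [jInv, jInv, div_eq_div_iff hσ hτ, ← hs] at h1
    refine mul_right_cancel₀ hτ ?_
    linear_combination h1
  have h6 : E₆ σ ^ 2 = (s ^ 6 * E₆ τ) ^ 2 := by
    have h1 := congrArg (· - (1728 : ℂ)) h
    simp only [jInv_sub_1728] at h1
    rw [div_eq_div_iff hσ hτ, ← hs] at h1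
    refine mul_right_cancel₀ hτ ?_
    linear_combination h1
  obtain ⟨ω, hω, hω4⟩ : ∃ ω : ℂ, ω ^ 3 = 1 ∧ E₄ σ = ω * (s ^ 4 * E₄ τ) := by
    by_cases h0 : E₄ τ = 0
    · refine ⟨1, one_pow _, ?_⟩
      rw [h0] at h4 ⊢
      simpa using h4
    · have h1 : s ^ 4 * E₄ τ ≠ 0 := mul_ne_zero (pow_ne_zero _ hs0) h0
      exact ⟨E₄ σ / (s ^ 4 * E₄ τ), by rw [div_pow, h4, div_self (pow_ne_zero _ h1)],
        (div_mul_cancel₀ _ h1).symm⟩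
  -- The sign is written as `κ ^ 6` with `κ ^ 4 = 1`, so that correcting `E₆` leaves `E₄` alone;
  -- likewise `ω ^ 6 = 1` and `ω ^ 4 = ω`. Hence `t = ω κ s` serves both.
  obtain ⟨κ, hκ4, hκ6⟩ : ∃ κ : ℂ, κ ^ 4 = 1 ∧ E₆ σ = κ ^ 6 * (s ^ 6 * E₆ τ) := by
    rcases sq_eq_sq_iff_eq_or_eq_neg.1 h6 with h1 | h1
    · exact ⟨1, by simp, by simpa using h1⟩
    · refine ⟨Complex.I, Complex.I_pow_four, ?_⟩
      rw [show Complex.I ^ 6 = Complex.I ^ 4 * Complex.I ^ 2 by ring, Complex.I_pow_four,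
        Complex.I_sq, h1]
      ring
  have hω0 : ω ≠ 0 := fun h0 => by simp [h0] at hω
  have hκ0 : κ ≠ 0 := fun h0 => by simp [h0] at hκ4
  refine ⟨ω * κ * s, mul_ne_zero (mul_ne_zero hω0 hκ0) hs0, ?_, ?_⟩
  · rw [hω4]
    linear_combination -(ω * s ^ 4 * E₄ τ) * (κ ^ 4 * hω + hκ4)
  · rw [hκ6]
    linear_combination -(κ ^ 6 * s ^ 6 * E₆ τ) * (ω ^ 3 + 1) * hω

theorem exists_tendsto_form {k : ℤ} (g : ModularForm 𝒮ℒ k) :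
    ∃ c : ℂ, Tendsto g atImInfty (𝓝 c) :=
  ⟨_, tendsto_of_hasSum_qParam (c := fun m => (qExpansion 1 g).coeff m) fun τ => by
    simpa [Function.Periodic.qParam] using
      ModularForm.hasSum_qExpansion g one_pos one_mem_strictPeriods_SL τ⟩

/-- Level one forms are polynomials in `E₄` and `E₆`, so they scale as these do. -/
theorem form_scaling {τ σ : ℍ} {t : ℂ} (ht : t ≠ 0) (h4 : E₄ σ = t ^ 4 * E₄ τ)
    (h6 : E₆ σ = t ^ 6 * E₆ τ) (n : ℕ) :
    ∀ k : ℤ, k < n → ∀ g : ModularForm 𝒮ℒ k, g σ = t ^ k * g τ := by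
  have hΔ : ModularForm.discriminant σ = t ^ 12 * ModularForm.discriminant τ := by
    rw [discriminant_eq_E₄_cube_sub_E₆_sq, discriminant_eq_E₄_cube_sub_E₆_sq, h4, h6]
    ring
  induction n with
  | zero =>
    intro k hk g
    have := ModularFormClass.levelOne_neg_weight_eq_zero (by simpa using hk) g
    simp [this]
  | succ n ih =>
    intro k hk g
    rcases lt_or_ge k 0 with hneg | hnn
    · have := ModularFormClass.levelOne_neg_weight_eq_zero hneg g
      simp [this]
    rcases Int.even_or_odd k with hev | hodd
    swap
    · simp [ModularForm.levelOne_odd_weight_eq_zero hodd g]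
    by_cases hk0 : k = 0
    · subst hk0
      obtain ⟨c, hc⟩ := ModularFormClass.levelOne_weight_zero_const g
      simp [hc]
    by_cases hk2 : k = 2
    · subst hk2
      have := rank_zero_iff_forall_zero.1 ModularForm.levelOne_weight_two_rank_zero g
      simp [this]
    -- The remaining weights are even and at least 4: multiples of 4 need no `E₆`, the others need
    -- one.
    obtain ⟨a, b, hab⟩ : ∃ a b : ℕ, k = a * 4 + b * 6 := by
      obtain ⟨l, hl⟩ := hev
      rcases Int.even_or_odd l with ⟨m, hm⟩ | ⟨m, hm⟩
      · exact ⟨m.toNat, 0, by omega⟩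
      · exact ⟨(m - 1).toNat, 1, by omega⟩
    let P : ModularForm 𝒮ℒ k := ModularForm.mcast hab.symm ((E₄.pow a).mul (E₆.pow b))
    have hP : ⇑P = fun z => E₄ z ^ a * E₆ z ^ b := by
      funext z
      simp [P]
    have hP1 : Tendsto P atImInfty (𝓝 1) := by
      have := ((tendsto_E (k := 4) (by norm_num) ⟨2, rfl⟩).pow a).mul
        ((tendsto_E (k := 6) (by norm_num) ⟨3, rfl⟩).pow b)
      rw [hP]
      simpa using this
    have hPs : P σ = t ^ k * P τ := by
      simp only [hP, h4, h6]
      rw [hab, zpow_add₀ ht, mul_comm (a : ℤ), mul_comm (b : ℤ), zpow_mul, zpow_mul, zpow_natCast,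
        zpow_natCast]
      norm_cast
      ring
    obtain ⟨c, hc⟩ := exists_tendsto_form g
    -- Removing the limit at `i∞` leaves a cusp form. It is `Δ` times a form of weight `k - 12`, to
    -- which the induction applies.
    let F : CuspForm 𝒮ℒ k := mkCuspForm (g - c • P : ModularForm 𝒮ℒ k) (g - c • P).holo'
      (slash_eq_of_form _) (by
        have := hc.sub (hP1.const_mul c)
        rw [mul_one, sub_self] at this
        exact this)
    have hF : ∀ z, F z = g z - c * P z := fun z => rfl
    have hdiv := fun z => discriminant_mul_discriminantEquiv_apply F z
    have hind := ih (k - 12) (by push_cast at hk; linarith) (CuspForm.discriminantEquiv F)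
    have h1 : F σ = t ^ k * F τ := by
      rw [← hdiv, ← hdiv, hind, hΔ, zpow_sub₀ ht]
      have : t ^ (12 : ℤ) = t ^ 12 := by norm_cast
      rw [this]
      field_simp
    rw [hF, hF, hPs] at h1
    linear_combination h1

/-! ### Period lattices. -/

/-- The pair of periods `t τ, t`. -/
def periodPair (τ : ℍ) (t : ℂ) (ht : t ≠ 0) : PeriodPair where
  ω₁ := t * τ
  ω₂ := t
  indep := by
    rw [LinearIndependent.pair_iff]
    intro a b hab
    have h1 : (a : ℂ) * τ + b = 0 := by
      refine (mul_eq_zero.1 ?_).resolve_left ht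
      simp only [Complex.real_smul] at hab
      linear_combination hab
    have ha : a = 0 := by
      have := congrArg Complex.im h1
      simpa [τ.im_ne_zero] using this
    subst ha
    simpa using h1

/-- The sum over the lattice `t (ℤ τ + ℤ)` is `t ^ (-n)` times the sum over all pairs of integers.
Extracting greatest common divisors turns the latter into `ζ(n)` times the sum over coprime pairs,
which is `2 E`. -/
theorem periodPair_G (τ : ℍ) {t : ℂ} (ht : t ≠ 0) {n : ℕ} (hn : 3 ≤ n) :
    (periodPair τ t ht).G n = (t ^ n)⁻¹ * (riemannZeta n * (2 * E hn τ)) := by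
  have h1 : (2 * E hn τ : ℂ) = eisensteinSeries (N := 1) 0 n τ := by
    rw [show E hn τ = (1 / 2 : ℂ) • eisensteinSeriesSIF (N := 1) 0 n τ from rfl,
      eisensteinSeriesSIF_apply 0 n τ]
    simp
  rw [h1, ← tsum_eisSummand_eq_riemannZeta_mul_eisensteinSeries hn, ← tsum_mul_left, PeriodPair.G,
    ← ((periodPair τ t ht).latticeEquivProd.symm.toEquiv).tsum_eq,
    ← (finTwoArrowEquiv ℤ).tsum_eq]
  refine tsum_congr fun v => ?_
  have h2 := (periodPair τ t ht).latticeEquiv_symm_apply (v 0, v 1)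
  change ((((periodPair τ t ht).latticeEquivProd.symm (v 0, v 1)).1 ^ n)⁻¹ : ℂ) = _
  rw [h2, eisSummand, zpow_neg, zpow_natCast, ← mul_inv, ← mul_pow]
  congr 2
  simp only [periodPair]
  ring

/-- The numbers `G n` are, up to fixed factors, the Laurent coefficients of `℘'` at 0. So the two
functions `℘'` agree near 0, hence everywhere by the identity theorem, and the lattice is recovered
as the set of poles. -/
theorem mem_lattice_of_G_eq {L L' : PeriodPair} (h : ∀ n, 3 ≤ n → L.G n = L'.G n) {x : ℂ}
    (hx : x ∈ L.lattice) : x ∈ L'.lattice := by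
  have hE : (fun z => L.derivWeierstrassPExcept 0 z) =ᶠ[𝓝 0] L'.derivWeierstrassPExcept 0 := by
    have h1 := L.hasFPowerSeriesAt_derivWeierstrassPExcept 0
    have h2 := L'.hasFPowerSeriesAt_derivWeierstrassPExcept 0
    have h3 : (FormalMultilinearSeries.ofScalars ℂ fun i : ℕ =>
        ((i : ℂ) + 1) * (i + 2) * L.sumInvPow 0 (i + 3)) = .ofScalars ℂ fun i : ℕ =>
        ((i : ℂ) + 1) * (i + 2) * L'.sumInvPow 0 (i + 3) := by
      congr 1
      funext i
      rw [PeriodPair.sumInvPow_zero, PeriodPair.sumInvPow_zero, h _ (by omega)]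
    rw [h3] at h1
    have h4 := h1.sub h2
    rw [sub_self] at h4
    filter_upwards [h4.eventually_eq_zero] with z hz
    exact sub_eq_zero.1 hz
  have hu : Meromorphic (L.derivWeierstrassP - L'.derivWeierstrassP) :=
    L.meromorphic_derivWeierstrassP.sub L'.meromorphic_derivWeierstrassP
  have h0 : meromorphicOrderAt (L.derivWeierstrassP - L'.derivWeierstrassP) 0 = ⊤ := by
    rw [meromorphicOrderAt_eq_top_iff]
    filter_upwards [hE.filter_mono nhdsWithin_le_nhds] with z hz
    have h1 := L.derivWeierstrassPExcept_sub 0 z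
    have h2 := L'.derivWeierstrassPExcept_sub 0 z
    simp only [ZeroMemClass.coe_zero] at h1 h2
    rw [Pi.sub_apply, ← h1, ← h2, hz, sub_self]
  have htop : meromorphicOrderAt (L.derivWeierstrassP - L'.derivWeierstrassP) x = ⊤ := by
    by_contra hne
    exact MeromorphicOn.meromorphicOrderAt_ne_top_of_isPreconnected (U := Set.univ)
      (fun z _ => hu z) isPreconnected_univ (Set.mem_univ x) (Set.mem_univ 0) hne h0
  have hev : L.derivWeierstrassP =ᶠ[𝓝[≠] x] L'.derivWeierstrassP := by
    rw [meromorphicOrderAt_eq_top_iff] at htop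
    filter_upwards [htop] with z hz
    exact sub_eq_zero.1 hz
  have hord : meromorphicOrderAt L.derivWeierstrassP x = ((-2 - 1 : ℤ) : WithTop ℤ) := by
    rw [← PeriodPair.deriv_weierstrassP]
    exact meromorphicOrderAt_deriv_eq_sub_one (by norm_num) (L.order_weierstrassP x hx)
  by_contra hx'
  have hnn := (L'.analyticOnNhd_derivWeierstrassP x hx').meromorphicOrderAt_nonneg
  rw [← meromorphicOrderAt_congr hev, hord] at hnn
  exact absurd hnn (by decide)

/-- Expressing each basis in the other gives two mutually inverse integral matrices, so the
determinant is `±1`; both points lie in the upper half plane, which fixes the sign. -/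
theorem exists_smul_eq_of_mem_lattice {τ σ : ℍ} {t : ℂ} (ht : t ≠ 0)
    (h : (periodPair τ 1 one_ne_zero).lattice = (periodPair σ t ht).lattice) :
    ∃ γ : SL(2, ℤ), γ • τ = σ := by
  obtain ⟨a, b, hab⟩ := PeriodPair.mem_lattice.1
    (h ▸ (periodPair σ t ht).ω₁_mem_lattice : _ ∈ (periodPair τ 1 one_ne_zero).lattice)
  obtain ⟨c, d, hcd⟩ := PeriodPair.mem_lattice.1
    (h ▸ (periodPair σ t ht).ω₂_mem_lattice : _ ∈ (periodPair τ 1 one_ne_zero).lattice)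
  obtain ⟨a', b', hab'⟩ := PeriodPair.mem_lattice.1
    (h ▸ (periodPair τ 1 one_ne_zero).ω₁_mem_lattice : _ ∈ (periodPair σ t ht).lattice)
  obtain ⟨c', d', hcd'⟩ := PeriodPair.mem_lattice.1
    (h ▸ (periodPair τ 1 one_ne_zero).ω₂_mem_lattice : _ ∈ (periodPair σ t ht).lattice)
  simp only [periodPair, one_mul, mul_one] at hab hcd hab' hcd'
  have indep : ∀ m n : ℤ, (m : ℂ) * τ + n = 0 → m = 0 ∧ n = 0 := fun m n hmn => by
    have hm : m = 0 := by
      have := congrArg Complex.im hmn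
      simpa [τ.im_ne_zero] using this
    subst hm
    exact ⟨rfl, by simpa using hmn⟩
  have e1 := indep (a' * a + b' * c - 1) (a' * b + b' * d) (by
    push_cast
    rw [← hab, ← hcd] at hab'
    linear_combination hab')
  have e2 := indep (c' * a + d' * c) (c' * b + d' * d - 1) (by
    push_cast
    rw [← hab, ← hcd] at hcd'
    linear_combination hcd')
  have hdet : (a' * d' - b' * c') * (a * d - b * c) = 1 := by
    linear_combination (c' * b + d' * d) * e1.1 + e2.2 - (c' * a + d' * c) * e1.2
  -- The imaginary part of `(a τ + b)` times the conjugate of `(c τ + d)` is `(a d - b c) Im τ`, and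
  -- it equals `‖t‖ ^ 2 Im σ`.
  have hpos : 0 < a * d - b * c := by
    have h1 : ((a : ℂ) * τ + b) * (starRingEnd ℂ) ((c : ℂ) * τ + d) =
        ((‖t‖ ^ 2 : ℝ) : ℂ) * σ := by
      rw [hab, hcd, mul_right_comm, Complex.mul_conj, Complex.normSq_eq_norm_sq]
    have h2 := congrArg Complex.im h1
    rw [Complex.im_ofReal_mul] at h2
    simp at h2
    have h3 : ((a * d - b * c : ℤ) : ℝ) * τ.im = ‖t‖ ^ 2 * σ.im := by
      push_cast
      linear_combination h2
    have h4 : 0 < ‖t‖ ^ 2 * σ.im := mul_pos (pow_pos (norm_pos_iff.2 ht) 2) σ.im_pos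
    rw [← h3] at h4
    exact_mod_cast pos_of_mul_pos_left h4 τ.im_pos.le
  have hone : a * d - b * c = 1 := by
    rcases Int.eq_one_or_neg_one_of_mul_eq_one (by rw [mul_comm]; exact hdet) with h1 | h1 <;> omega
  let γ : SL(2, ℤ) := ⟨!![a, b; c, d], by rw [Matrix.det_fin_two_of]; exact hone⟩
  refine ⟨γ, ?_⟩
  apply UpperHalfPlane.ext
  rw [coe_specialLinearGroup_apply]
  have h00 : γ 0 0 = a := rfl
  have h01 : γ 0 1 = b := rfl
  have h10 : γ 1 0 = c := rfl
  have h11 : γ 1 1 = d := rfl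
  rw [h00, h01, h10, h11]
  simp only [algebraMap_int_eq, eq_intCast, Complex.ofReal_intCast]
  rw [hab, hcd, mul_comm, mul_div_assoc, div_self ht, mul_one]

/-- The scaling of `E₄` and `E₆` by powers of `t` passes to all Eisenstein series, so `ℤ τ + ℤ` and
`t (ℤ σ + ℤ)` have the same `G n`, and therefore coincide. -/
theorem exists_smul_eq_of_jInv_eq {τ σ : ℍ} (h : jInv σ = jInv τ) : ∃ γ : SL(2, ℤ), γ • τ = σ := by
  obtain ⟨t, ht, h4, h6⟩ := exists_scaling_of_jInv_eq h
  have hG : ∀ n, 3 ≤ n → (periodPair τ 1 one_ne_zero).G n = (periodPair σ t ht).G n := fun n hn => by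
    have := form_scaling ht h4 h6 (n + 1) n (by push_cast; linarith) (E hn)
    rw [periodPair_G _ _ hn, periodPair_G _ _ hn, this]
    simp only [zpow_natCast]
    have : t ^ n ≠ 0 := pow_ne_zero _ ht
    field_simp
    simp
  refine exists_smul_eq_of_mem_lattice ht (le_antisymm ?_ ?_)
  · exact fun x hx => mem_lattice_of_G_eq hG hx
  · exact fun x hx => mem_lattice_of_G_eq (fun n hn => (hG n hn).symm) hx

end

end RationalWeight

namespace RationalWeight

noncomputable section

/-! ### Stabilizers and cosets -/

/-- The preimage in `SL(2, ℤ)` of the image of `G` in `SL(2, ℤ) / {±I}`. -/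
def withCenter (G : Subgroup SL(2, ℤ)) : Subgroup SL(2, ℤ) := G ⊔ Subgroup.center SL(2, ℤ)

theorem mem_center_iff {γ : SL(2, ℤ)} :
    γ ∈ Subgroup.center SL(2, ℤ) ↔ γ = 1 ∨ γ = -1 := by
  rw [Matrix.SpecialLinearGroup.mem_center_iff]
  constructor
  · rintro ⟨r, hr, h⟩
    rw [Fintype.card_fin] at hr
    rcases Int.isUnit_iff.1 (IsUnit.of_pow_eq_one hr two_ne_zero) with rfl | rfl
    · left
      ext1
      rw [← h]
      simp
    · right
      ext1
      rw [← h]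
      simp
  · rintro (rfl | rfl)
    · exact ⟨1, by simp, by simp⟩
    · exact ⟨-1, by simp, by simp⟩

theorem neg_one_smul_onePoint (x : OnePoint ℚ) : (-1 : SL(2, ℤ)) • x = x := by
  change Matrix.SpecialLinearGroup.mapGL ℚ (-1 : SL(2, ℤ)) • x = x
  cases x with
  | infty => rw [OnePoint.smul_infty_eq_self_iff]; simp
  | coe q => simp [OnePoint.smul_some_eq_ite]

theorem center_smul {γ : SL(2, ℤ)} (h : γ ∈ Subgroup.center SL(2, ℤ)) (x : ExtUHP) : γ • x = x := by
  rcases mem_center_iff.1 h with rfl | rfl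
  · exact one_smul _ x
  · cases x with
    | inl τ =>
      change Sum.inl ((-1 : SL(2, ℤ)) • τ) = _
      rw [ModularGroup.SL_neg_smul, one_smul]
    | inr x =>
      change Sum.inr ((-1 : SL(2, ℤ)) • x) = _
      rw [neg_one_smul_onePoint]

theorem center_le_stabilizer (x : ExtUHP) :
    Subgroup.center SL(2, ℤ) ≤ MulAction.stabilizer SL(2, ℤ) x :=
  fun _ h => center_smul h x

theorem mem_withCenter {G : Subgroup SL(2, ℤ)} {γ : SL(2, ℤ)} :
    γ ∈ withCenter G ↔ ∃ g ∈ G, ∃ z ∈ Subgroup.center SL(2, ℤ), g * z = γ :=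
  Subgroup.mem_sup_of_normal_right

theorem mk_eq_mk_iff {G : Subgroup SL(2, ℤ)} {x y : ExtUHP} :
    ModularCurve.mk G x = ModularCurve.mk G y ↔ ∃ g ∈ withCenter G, g • y = x := by
  rw [ModularCurve.mk, ModularCurve.mk, Quotient.eq]
  change x ∈ MulAction.orbit G y ↔ _
  constructor
  · rintro ⟨g, hg⟩
    exact ⟨g, Subgroup.mem_sup_left g.2, hg⟩
  · rintro ⟨γ, hγ, h⟩
    obtain ⟨g, hg, z, hz, rfl⟩ := mem_withCenter.1 hγ
    rw [mul_smul, center_smul hz] at h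
    exact ⟨⟨g, hg⟩, h⟩

theorem index_bar (G : Subgroup SL(2, ℤ)) : (bar G).index = (withCenter G).index := by
  rw [bar, Subgroup.index_map, QuotientGroup.ker_mk',
    MonoidHom.range_eq_top_of_surjective _ (QuotientGroup.mk'_surjective _), Subgroup.index_top,
    mul_one, withCenter]

theorem relIndex_barStabilizer (G : Subgroup SL(2, ℤ)) (x : ExtUHP) :
    (barStabilizer G x).relIndex (barStabilizer ⊤ x) =
      (withCenter G).relIndex (MulAction.stabilizer SL(2, ℤ) x) := by
  have hZ := center_le_stabilizer x
  rw [barStabilizer, barStabilizer, bar, bar, Subgroup.relIndex_map_map, QuotientGroup.ker_mk',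
    top_inf_eq, sup_of_le_left hZ, ← Subgroup.inf_relIndex_right (withCenter G)]
  congr 1
  ext γ
  rw [Subgroup.mem_sup_of_normal_right, Subgroup.mem_inf, mem_withCenter]
  constructor
  · rintro ⟨g, hg, z, hz, rfl⟩
    exact ⟨⟨g, hg.1, z, hz, rfl⟩, mul_mem hg.2 (hZ hz)⟩
  · rintro ⟨⟨g, hg, z, hz, rfl⟩, h⟩
    exact ⟨g, ⟨hg, (Subgroup.mul_mem_cancel_right _ (hZ hz)).1 h⟩, z, hz, rfl⟩

/-- Multiplicativity of the index over the trivial subgroup. It exchanges division by the order of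
the stabilizer in `G` for division by the full one, at the cost of the index that is the width at a
cusp. -/
theorem card_barStabilizer_mul (G : Subgroup SL(2, ℤ)) (x : ExtUHP) :
    Nat.card (barStabilizer G x) * (withCenter G).relIndex (MulAction.stabilizer SL(2, ℤ) x) =
      Nat.card (barStabilizer ⊤ x) := by
  rw [← relIndex_barStabilizer, ← Subgroup.relIndex_bot_left, ← Subgroup.relIndex_bot_left]
  refine Subgroup.relIndex_mul_relIndex _ _ _ bot_le ?_
  exact Subgroup.map_mono (inf_le_inf_right _ le_top)

theorem card_center : Nat.card (Subgroup.center SL(2, ℤ)) = 2 := by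
  have : ((Subgroup.center SL(2, ℤ) : Subgroup SL(2, ℤ)) : Set SL(2, ℤ)) = {1, -1} := by
    ext γ
    simp [mem_center_iff]
  rw [← SetLike.coe_sort_coe, this, Nat.card_coe_set_eq, Set.ncard_pair]
  intro h
  have := congrArg (fun A : SL(2, ℤ) => A 0 0) h
  simp at this

theorem two_mul_card_barStabilizer_top (x : ExtUHP) :
    2 * Nat.card (barStabilizer ⊤ x) = Nat.card (MulAction.stabilizer SL(2, ℤ) x) := by
  have h : Nat.card (barStabilizer ⊤ x) =
      (Subgroup.center SL(2, ℤ)).relIndex (MulAction.stabilizer SL(2, ℤ) x) := by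
    rw [barStabilizer, bar, top_inf_eq, ← Subgroup.relIndex_ker, QuotientGroup.ker_mk']
  have h2 := Subgroup.relIndex_mul_relIndex ⊥ _ _ bot_le (center_le_stabilizer x)
  rw [Subgroup.relIndex_bot_left, Subgroup.relIndex_bot_left, card_center] at h2
  rw [h, h2]

theorem card_barStabilizer_top_smul (γ : SL(2, ℤ)) (x : ExtUHP) :
    Nat.card (barStabilizer ⊤ (γ • x)) = Nat.card (barStabilizer ⊤ x) := by
  have h1 := two_mul_card_barStabilizer_top x
  have h2 := two_mul_card_barStabilizer_top (γ • x)
  have h3 := Nat.card_congr (MulAction.stabilizerEquivStabilizer (rfl : γ • x = γ • x)).toEquiv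
  omega

/-! ### Cosets of `±G` and the fibres of `X_G` over the level one curve. -/

section Cosets

variable (G : Subgroup SL(2, ℤ))

theorem mk_out_inv_smul (γ : SL(2, ℤ)) (z : ExtUHP) :
    ModularCurve.mk G ((γ : SL(2, ℤ) ⧸ withCenter G).out⁻¹ • z) =
      ModularCurve.mk G (γ⁻¹ • z) := by
  obtain ⟨h, hh⟩ := QuotientGroup.mk_out_eq_mul (withCenter G) γ
  rw [hh, mul_inv_rev, mul_smul]
  exact mk_eq_mk_iff.2 ⟨_, inv_mem h.2, rfl⟩

/-- The number of cosets that map `z` to a given point of the modular curve. -/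
theorem ncard_coset_fiber (δ : SL(2, ℤ)) (z : ExtUHP) :
    {q : SL(2, ℤ) ⧸ withCenter G |
      ModularCurve.mk G (q.out⁻¹ • z) = ModularCurve.mk G (δ • z)}.ncard =
      (withCenter G).relIndex (MulAction.stabilizer SL(2, ℤ) (δ • z)) := by
  set S := MulAction.stabilizer SL(2, ℤ) (δ • z) with hS
  -- Orbit and stabilizer: the index is the size of the orbit of the trivial coset under the
  -- stabilizer of `δ • z`, and translation by `δ⁻¹` carries this orbit onto the fibre.
  have h1 : (withCenter G).relIndex S =
      (MulAction.orbit S ((1 : SL(2, ℤ)) : SL(2, ℤ) ⧸ withCenter G)).ncard := by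
    rw [← MulAction.index_stabilizer, Subgroup.relIndex]
    congr 1
    ext s
    rw [Subgroup.mem_subgroupOf, MulAction.mem_stabilizer_iff]
    change _ ↔ ((s * 1 : SL(2, ℤ)) : SL(2, ℤ) ⧸ withCenter G) = _
    rw [eq_comm, QuotientGroup.eq]
    simp
  rw [h1, ← Set.ncard_image_of_injective
    (MulAction.orbit S ((1 : SL(2, ℤ)) : SL(2, ℤ) ⧸ withCenter G)) (MulAction.injective δ⁻¹)]
  congr 1
  ext q
  induction q using QuotientGroup.induction_on with
  | H γ =>
  rw [Set.mem_ofPred_eq, mk_out_inv_smul, mk_eq_mk_iff]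
  constructor
  · rintro ⟨g, hg, h⟩
    refine ⟨((δ * γ * g : SL(2, ℤ)) : SL(2, ℤ) ⧸ withCenter G),
      ⟨⟨δ * γ * g, ?_⟩, ?_⟩, ?_⟩
    · rw [hS, MulAction.mem_stabilizer_iff, mul_smul, h, mul_smul, smul_inv_smul]
    · change ((δ * γ * g * 1 : SL(2, ℤ)) : SL(2, ℤ) ⧸ withCenter G) = _
      rw [mul_one]
    · change ((δ⁻¹ * (δ * γ * g) : SL(2, ℤ)) : SL(2, ℤ) ⧸ withCenter G) = _
      rw [QuotientGroup.eq]
      convert inv_mem hg using 1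
      group
  · rintro ⟨_, ⟨s, rfl⟩, h⟩
    change ((δ⁻¹ * (s * 1) : SL(2, ℤ)) : SL(2, ℤ) ⧸ withCenter G) = _ at h
    rw [QuotientGroup.eq] at h
    refine ⟨_, inv_mem h, ?_⟩
    have hs : (s : SL(2, ℤ)) • δ • z = δ • z := s.2
    rw [mul_one, mul_inv_rev, inv_inv, mul_smul, mul_smul, hs, inv_smul_smul]

variable [(withCenter G).FiniteIndex]

instance : Fintype (SL(2, ℤ) ⧸ withCenter G) := Fintype.ofFinite _

-- Cosets leading to the same point of `X_G` contribute equally, and their number is exactly the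
-- factor between `a` and `d`.
open Classical in
theorem sum_cosets_eq (a d : ModularCurve G → ℝ) (hd : ∀ y, d (ModularCurve.mk G y) =
      a (ModularCurve.mk G y) * (withCenter G).relIndex (MulAction.stabilizer SL(2, ℤ) y))
    (z : ExtUHP) :
    ∑ q : SL(2, ℤ) ⧸ withCenter G, a (ModularCurve.mk G (q.out⁻¹ • z)) =
      ∑ x ∈ Finset.univ.image
        (fun q : SL(2, ℤ) ⧸ withCenter G => ModularCurve.mk G (q.out⁻¹ • z)), d x := by
  rw [Finset.sum_comp a (fun q : SL(2, ℤ) ⧸ withCenter G => ModularCurve.mk G (q.out⁻¹ • z))]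
  refine Finset.sum_congr rfl fun x hx => ?_
  obtain ⟨p, -, rfl⟩ := Finset.mem_image.1 hx
  rw [hd, ← ncard_coset_fiber, nsmul_eq_mul, mul_comm, Set.ncard_eq_toFinset_card']
  congr 3
  ext q
  simp

/-- The degree of a divisor as a sum over orbits of `SL(2, ℤ)` and cosets. -/
theorem sum_eq_sum_cosets (a : ModularCurve G → ℝ) (d : ModularCurve G →₀ ℝ)
    (hd : ∀ y, d (ModularCurve.mk G y) =
      a (ModularCurve.mk G y) * (withCenter G).relIndex (MulAction.stabilizer SL(2, ℤ) y))
    (s : Finset ExtUHP) (hs : ∀ y ∈ s, ∀ z ∈ s, ∀ γ : SL(2, ℤ), γ • y = z → y = z)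
    (hcov : ∀ y, d (ModularCurve.mk G y) ≠ 0 → ∃ z ∈ s, ∃ γ : SL(2, ℤ), γ • z = y) :
    degree d = ∑ z ∈ s, ∑ q : SL(2, ℤ) ⧸ withCenter G, a (ModularCurve.mk G (q.out⁻¹ • z)) := by
  classical
  simp_rw [sum_cosets_eq G a d hd]
  rw [← Finset.sum_biUnion, degree, Finsupp.sum]
  · refine Finset.sum_subset ?_ fun x _ hx => Finsupp.notMem_support_iff.1 hx
    intro x hx
    obtain ⟨y, rfl⟩ : ∃ y, ModularCurve.mk G y = x := Quotient.exists_rep x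
    obtain ⟨z, hz, γ, rfl⟩ := hcov y (Finsupp.mem_support_iff.1 hx)
    refine Finset.mem_biUnion.2 ⟨z, hz, Finset.mem_image.2
      ⟨((γ⁻¹ : SL(2, ℤ)) : SL(2, ℤ) ⧸ withCenter G), Finset.mem_univ _, ?_⟩⟩
    rw [mk_out_inv_smul, inv_inv]
  · intro y hy z hz hne
    rw [Function.onFun, Finset.disjoint_left]
    intro x hx hx'
    obtain ⟨p, -, rfl⟩ := Finset.mem_image.1 hx
    obtain ⟨q, -, h⟩ := Finset.mem_image.1 hx'
    obtain ⟨g, -, hg⟩ := mk_eq_mk_iff.1 h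
    refine hne (hs y hy z hz (q.out * g * p.out⁻¹) ?_)
    rw [mul_smul, mul_smul, hg, smul_inv_smul]

end Cosets

/-! ### Elliptic points -/

section Elliptic

open ModularForm EisensteinSeries ModularGroup

theorem form_smul {k : ℤ} (f : ModularForm 𝒮ℒ k) (γ : SL(2, ℤ)) (τ : ℍ) :
    f (γ • τ) = denom γ τ ^ k * f τ := by
  have h := congrFun (slash_eq_of_form f γ) τ
  rw [SL_slash_apply] at h
  have hd : denom γ τ ≠ 0 := denom_ne_zero _ τ
  rw [← h, mul_comm, mul_assoc, ← zpow_add₀ hd, neg_add_cancel, zpow_zero, mul_one]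

theorem discriminant_smul (γ : SL(2, ℤ)) (τ : ℍ) :
    ModularForm.discriminant (γ • τ) = denom γ τ ^ 12 * ModularForm.discriminant τ := by
  have h := congrFun (CuspForm.discriminant.slash_action_eq' _ ⟨γ, rfl⟩) τ
  change (ModularForm.discriminant ∣[(12 : ℤ)] γ) τ = ModularForm.discriminant τ at h
  rw [SL_slash_apply] at h
  have hd : denom γ τ ≠ 0 := denom_ne_zero _ τ
  rw [← h, mul_comm, mul_assoc, ← zpow_natCast, ← zpow_add₀ hd]
  norm_num

theorem jInv_smul (γ : SL(2, ℤ)) (τ : ℍ) : jInv (γ • τ) = jInv τ := by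
  have hd : denom γ τ ≠ 0 := denom_ne_zero _ τ
  rw [jInv, jInv, discriminant_smul, form_smul]
  have : denom γ τ ^ (4 : ℤ) = denom γ τ ^ 4 := by norm_cast
  simp only [this]
  have hΔ := discriminant_ne_zero τ
  field_simp

/-- `S` fixes `i`, and its factor in weight 6 is `i ^ 6 = -1`. -/
theorem E₆_I : E₆ I = 0 := by
  have h := form_smul E₆ S I
  rw [stabilizer_I.2 (by simp), denom_S] at h
  have h6 : ((I : ℍ) : ℂ) ^ (6 : ℤ) = -1 := by
    have : ((I : ℍ) : ℂ) ^ (6 : ℤ) = (Complex.I ^ 2) ^ 3 := by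
      rw [← pow_mul, coe_I]
      norm_cast
    rw [this, Complex.I_sq]
    norm_num
  simp only [h6] at h
  linear_combination h / 2

/-- `S * T` fixes `ρ`, and its factor in weight 4 is `(ρ + 1) ^ 4 = -ρ - 1`, which is not 1. -/
theorem E₄_ρ : E₄ ρ = 0 := by
  have h := form_smul E₄ (S * T) ρ
  rw [stabilizer_ρ.2 (by simp)] at h
  have hd : denom (S * T : SL(2, ℤ)) ρ = (ρ : ℂ) + 1 := by
    rw [← autFactor_eq_denom, autFactor]
    rw [show (S * T) 1 0 = 1 by decide, show (S * T) 1 1 = 1 by decide]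
    simp
  have h3 : ((ρ : ℂ) + 1) ^ (4 : ℤ) = -ρ - 1 := by
    have : ((ρ : ℂ) + 1) ^ (4 : ℤ) = ((ρ : ℂ) + 1) ^ 4 := by norm_cast
    rw [this]
    linear_combination ((ρ : ℂ) ^ 2 + 3 * ρ + 2) * ρ_sq
  simp only [hd, h3] at h
  have hne : (ρ : ℂ) + 2 ≠ 0 := fun h1 => by
    have := congrArg Complex.im h1
    have h2 := ρ.im_pos
    simp at this
    exact h2.ne' this
  have : (E₄ ρ) * ((ρ : ℂ) + 2) = 0 := by linear_combination h
  exact (mul_eq_zero.1 this).resolve_right hne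

theorem card_stabilizer_inl (τ : ℍ) (s : Finset SL(2, ℤ)) (h : ∀ g : SL(2, ℤ), g • τ = τ ↔ g ∈ s) :
    Nat.card (MulAction.stabilizer SL(2, ℤ) (Sum.inl τ : ExtUHP)) = s.card := by
  have : ((MulAction.stabilizer SL(2, ℤ) (Sum.inl τ : ExtUHP) : Subgroup SL(2, ℤ)) :
      Set SL(2, ℤ)) = s := by
    ext g
    rw [SetLike.mem_coe, MulAction.mem_stabilizer_iff, Finset.mem_coe, ← h]
    exact Sum.inl_injective.eq_iff
  rw [← SetLike.coe_sort_coe, this, Nat.card_coe_set_eq, Set.ncard_coe_finset]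

theorem card_barStabilizer_I : Nat.card (barStabilizer ⊤ (Sum.inl I)) = 2 := by
  have h1 := two_mul_card_barStabilizer_top (Sum.inl I)
  rw [card_stabilizer_inl I _ fun g => stabilizer_I,
    show ({1, -1, S, -S} : Finset SL(2, ℤ)).card = 4 by decide] at h1
  omega

theorem card_barStabilizer_ρ : Nat.card (barStabilizer ⊤ (Sum.inl ρ)) = 3 := by
  have h1 := two_mul_card_barStabilizer_top (Sum.inl ρ)
  rw [card_stabilizer_inl ρ _ fun g => stabilizer_ρ,
    show ({1, -1, S * T, -(S * T), T⁻¹ * S, -(T⁻¹ * S)} : Finset SL(2, ℤ)).card = 6 by decide] at h1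
  omega

/-- The order of `j - j(τ)` at `τ` is the order of the stabilizer of `τ`. -/
theorem ordAt_jInv_sub (τ : ℍ) :
    ordAt (fun σ => jInv σ - jInv τ) τ = (Nat.card (barStabilizer ⊤ (Sum.inl τ)) : ℤ) := by
  by_cases h4 : E₄ τ = 0
  · have : jInv τ = jInv ρ := by simp [jInv, h4, E₄_ρ]
    obtain ⟨γ, rfl⟩ := exists_smul_eq_of_jInv_eq this
    rw [ordAt_jInv_sub_of_E₄_eq_zero h4,
      show (Sum.inl (γ • ρ) : ExtUHP) = γ • Sum.inl ρ from rfl, card_barStabilizer_top_smul,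
      card_barStabilizer_ρ]
    rfl
  by_cases h6 : E₆ τ = 0
  · have : jInv τ = jInv I := by
      have h1 := jInv_sub_1728 τ
      have h2 := jInv_sub_1728 I
      rw [h6] at h1
      rw [E₆_I] at h2
      linear_combination h1 - h2
    obtain ⟨γ, rfl⟩ := exists_smul_eq_of_jInv_eq this
    rw [ordAt_jInv_sub_of_E₆_eq_zero h6,
      show (Sum.inl (γ • I) : ExtUHP) = γ • Sum.inl I from rfl, card_barStabilizer_top_smul,
      card_barStabilizer_I]
    rfl
  -- In the fundamental domain only `i`, `ρ` and `ρ + 1` have stabilizers larger than `±1`; they are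
  -- excluded because `E₆` or `E₄` vanishes there.
  · obtain ⟨γ, hγ⟩ := exists_smul_mem_fd τ
    have e4 : E₄ (γ • τ) ≠ 0 := by
      rw [form_smul]
      exact mul_ne_zero (zpow_ne_zero _ (denom_ne_zero _ τ)) h4
    have e6 : E₆ (γ • τ) ≠ 0 := by
      rw [form_smul]
      exact mul_ne_zero (zpow_ne_zero _ (denom_ne_zero _ τ)) h6
    have hc : Nat.card (barStabilizer ⊤ (Sum.inl (γ • τ))) = 1 := by
      have h1 := two_mul_card_barStabilizer_top (Sum.inl (γ • τ))
      rw [card_stabilizer_inl (γ • τ) {1, -1} fun g => ?_,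
        show ({1, -1} : Finset SL(2, ℤ)).card = 2 by decide] at h1
      · omega
      · constructor
        · intro hg
          have := stabilizer_of_ne hγ hg (fun h => e6 (h ▸ E₆_I)) (fun h => e4 (h ▸ E₄_ρ))
            (fun h => e4 ?_)
          · simpa using this
          · rw [h, ← modular_T_smul, form_smul, E₄_ρ, mul_zero]
        · intro hg
          rcases (by simpa using hg : g = 1 ∨ g = -1) with rfl | rfl
          · exact one_smul _ _
          · rw [SL_neg_smul, one_smul]
    rw [ordAt_jInv_sub_of_ne_zero h4 h6, ← card_barStabilizer_top_smul γ,
      show γ • (Sum.inl τ : ExtUHP) = Sum.inl (γ • τ) from rfl, hc]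
    rfl

/-- The possible orders are 3, 2 and 1. Being divisors of 12, they allow the twelfth power of a
function to be cleared by integral powers of `j - j(τ)`. -/
theorem card_barStabilizer_mem (τ : ℍ) :
    Nat.card (barStabilizer ⊤ (Sum.inl τ)) ≠ 0 ∧ Nat.card (barStabilizer ⊤ (Sum.inl τ)) ∣ 6 := by
  have h := ordAt_jInv_sub τ
  by_cases h4 : E₄ τ = 0
  · rw [ordAt_jInv_sub_of_E₄_eq_zero h4] at h
    have : ((3 : ℤ) : WithTop ℤ) = (Nat.card (barStabilizer ⊤ (Sum.inl τ)) : ℤ) := h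
    have h3 : Nat.card (barStabilizer ⊤ (Sum.inl τ)) = 3 := by exact_mod_cast this.symm
    rw [h3]; decide
  by_cases h6 : E₆ τ = 0
  · rw [ordAt_jInv_sub_of_E₆_eq_zero h6] at h
    have : ((2 : ℤ) : WithTop ℤ) = (Nat.card (barStabilizer ⊤ (Sum.inl τ)) : ℤ) := h
    have h3 : Nat.card (barStabilizer ⊤ (Sum.inl τ)) = 2 := by exact_mod_cast this.symm
    rw [h3]; decide
  · rw [ordAt_jInv_sub_of_ne_zero h4 h6] at h
    have : ((1 : ℤ) : WithTop ℤ) = (Nat.card (barStabilizer ⊤ (Sum.inl τ)) : ℤ) := h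
    have h3 : Nat.card (barStabilizer ⊤ (Sum.inl τ)) = 1 := by exact_mod_cast this.symm
    rw [h3]; decide

end Elliptic

end

end RationalWeight

namespace RationalWeight

noncomputable section

open Filter Topology ModularForm EisensteinSeries
open scoped Manifold

/-! ### The degree formula in level one and weight zero -/

theorem hasExponent_discriminant : HasExponent ModularForm.discriminant 1 := by
  refine ⟨1, one_ne_zero, tendsto_atImInfty_tprod_one_sub_eta_q_pow.congr fun τ => ?_⟩
  rw [discriminant_eq_q_prod, Function.Periodic.qParam, mul_right_comm, ← Complex.exp_add]
  simp

/-- Over the denominator `Δ` the numerator is `E₄ ^ 3 - c Δ`, which tends to 1. -/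
theorem hasExponent_jInv_sub (c : ℂ) : HasExponent (fun τ => jInv τ - c) (-1) := by
  have h4 : HasExponent (fun τ => E₄ τ ^ 3 - c * ModularForm.discriminant τ) 0 := by
    refine ⟨1, one_ne_zero, ?_⟩
    have h1 := tendsto_E (k := 4) (by norm_num) ⟨2, rfl⟩
    have := (h1.pow 3).sub (discriminant_isZeroAtImInfty.const_mul c)
    simpa using! this
  have := h4.mul hasExponent_discriminant.inv
  rw [zero_add] at this
  refine this.congr' (Eventually.of_forall fun τ => ?_)
  have := discriminant_ne_zero τ
  simp only [jInv]
  field_simp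

theorem HasExponent.tendsto_zero {f : ℍ → ℂ} {r : ℝ} (hf : HasExponent f r) (hr : 0 < r) :
    Tendsto f atImInfty (𝓝 0) := by
  obtain ⟨A, a, b, -, h⟩ := hf.exists_bounds
  have h1 : Tendsto (fun τ : ℍ => b * Real.exp (-(2 * Real.pi * r * τ.im))) atImInfty
      (𝓝 (b * 0)) := by
    refine (Real.tendsto_exp_neg_atTop_nhds_zero.comp ?_).const_mul b
    refine tendsto_im_atImInfty.const_mul_atTop ?_
    have := Real.pi_pos
    positivity
  rw [mul_zero] at h1
  refine squeeze_zero_norm' ?_ h1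
  filter_upwards [tendsto_im_atImInfty.eventually_ge_atTop A] with τ hτ
  exact (h τ hτ).2

/-- The holomorphic function that agrees with a meromorphic function of order zero. -/
theorem exists_mdiff_eq {F : ℍ → ℂ} (hF : IsMero F) (h0 : ∀ τ, ordAt F τ = 0) :
    ∃ F' : ℍ → ℂ, MDiff F' ∧ (∀ τ : ℍ, ∀ᶠ σ : ℍ in 𝓝[≠] τ, F' σ = F σ) ∧ ∀ τ, F' τ ≠ 0 := by
  have hU := isMero_iff.1 hF
  set N := toMeromorphicNFOn (F ∘ ofComplex) {z : ℂ | 0 < z.im} with hN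
  have hNF : ∀ τ : ℍ, MeromorphicNFAt N (τ : ℂ) := fun τ =>
    meromorphicNFOn_toMeromorphicNFOn _ _ τ.im_pos
  have hord : ∀ τ : ℍ, meromorphicOrderAt N (τ : ℂ) = 0 := fun τ => by
    rw [hN, meromorphicOrderAt_toMeromorphicNFOn hU τ.im_pos]
    exact h0 τ
  refine ⟨fun τ => N τ, ?_, fun τ => ?_, fun τ => ?_⟩
  · rw [UpperHalfPlane.mdifferentiable_iff]
    intro z hz
    have ha := ((hNF ⟨z, hz⟩).meromorphicOrderAt_nonneg_iff_analyticAt.1 (hord ⟨z, hz⟩).ge)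
    refine (ha.differentiableAt.congr_of_eventuallyEq ?_).differentiableWithinAt
    filter_upwards [isOpen_upperHalfPlaneSet.mem_nhds hz] with w hw
    simp [ofComplex_apply_of_im_pos hw]
  · have := hU.toMeromorphicNFOn_eq_self_on_nhdsNE τ.im_pos
    have h1 := nhdsNE_eventually_iff.1 this
    filter_upwards [h1] with σ hσ
    simpa [hN] using hσ
  · exact (hNF τ).meromorphicOrderAt_eq_zero_iff.1 (hord τ)

theorem nhdsNE_neBot (τ : ℍ) : NeBot (𝓝[≠] τ) := by
  by_contra h
  have h1 : ∀ᶠ σ : ℍ in 𝓝[≠] τ, (fun _ : ℂ => False) σ := by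
    rw [not_neBot.1 h]
    exact eventually_bot
  exact (nhdsNE_eventually_iff.2 h1).exists.elim fun _ h => h

theorem eq_of_eventuallyEq_nhdsNE {f g : ℍ → ℂ} (hf : Continuous f) (hg : Continuous g) {τ : ℍ}
    (h : ∀ᶠ σ : ℍ in 𝓝[≠] τ, f σ = g σ) : f τ = g τ := by
  have := nhdsNE_neBot τ
  exact tendsto_nhds_unique ((hf.tendsto τ).mono_left nhdsWithin_le_nhds |>.congr' h)
    ((hg.tendsto τ).mono_left nhdsWithin_le_nhds)

/-- An invariant function without zeros and poles on the upper half plane does not vanish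
at `i∞`. -/
theorem exponent_nonpos_of_invariant {F : ℍ → ℂ} (hF : IsMero F) (h0 : ∀ τ, ordAt F τ = 0)
    (hinv : ∀ (γ : SL(2, ℤ)) τ, F (γ • τ) = F τ) {R : ℝ} (hR : HasExponent F R) : R ≤ 0 := by
  by_contra! hpos
  obtain ⟨F', hd, he, hne⟩ := exists_mdiff_eq hF h0
  have hc : Continuous F' := hd.continuous
  -- A positive exponent would make `F'` a cusp form of weight zero, hence zero, while it has no
  -- zeros. Since `F'` is known to equal `F` only on punctured neighbourhoods, invariance and the
  -- limit pass to it by continuity.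
  refine hne I (congrFun (eq_zero_of_tendsto_zero (k := 0) (by norm_num) F' hd (fun γ => ?_) ?_) I)
  · funext τ
    rw [SL_slash_apply, neg_zero, zpow_zero, mul_one]
    refine eq_of_eventuallyEq_nhdsNE (f := fun τ => F' (γ • τ)) (τ := τ)
      (hc.comp (DCover.continuous_smul_uhp γ)) hc ?_
    have h1 : Tendsto (fun σ : ℍ => γ • σ) (𝓝[≠] τ) (𝓝[≠] (γ • τ)) :=
      tendsto_nhdsWithin_of_tendsto_nhds_of_eventually_within _
        (((DCover.continuous_smul_uhp γ).tendsto τ).mono_left nhdsWithin_le_nhds) (by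
          filter_upwards [self_mem_nhdsWithin] with σ hσ h
          exact hσ (MulAction.injective γ h))
    filter_upwards [h1.eventually (he (γ • τ)), he τ] with σ h2 h3
    rw [h2, h3, hinv]
  · rw [Metric.tendsto_nhds]
    intro ε hε
    obtain ⟨A, hA⟩ := (atImInfty_mem _).1
      ((Metric.tendsto_nhds.1 (hR.tendsto_zero hpos)) (ε / 2) (half_pos hε))
    filter_upwards [tendsto_im_atImInfty.eventually_gt_atTop A] with τ hτ
    have := nhdsNE_neBot τ
    refine (le_of_tendsto (((hc.tendsto τ).mono_left
      (nhdsWithin_le_nhds (s := {τ}ᶜ))).dist tendsto_const_nhds) ?_).trans_lt (half_lt_self hε)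
    have hev : ∀ᶠ σ : ℍ in 𝓝[≠] τ, A < σ.im := eventually_nhdsWithin_of_eventually_nhds
      (UpperHalfPlane.continuous_im.continuousAt.eventually_const_lt hτ)
    filter_upwards [he τ, hev] with σ h1 h2
    rw [h1]
    exact le_of_lt (hA σ h2.le)

/-- The inverse of `F` satisfies the same hypotheses with exponent `-R`. -/
theorem exponent_eq_zero_of_invariant {F : ℍ → ℂ} (hF : IsMero F) (h0 : ∀ τ, ordAt F τ = 0)
    (hinv : ∀ (γ : SL(2, ℤ)) τ, F (γ • τ) = F τ) {R : ℝ} (hR : HasExponent F R) : R = 0 := by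
  refine le_antisymm (exponent_nonpos_of_invariant hF h0 hinv hR) ?_
  have := exponent_nonpos_of_invariant (hF.zpow (-1))
    (fun τ => by rw [ordAt_zpow hF, h0, mul_zero]) (fun γ τ => by rw [hinv]) (hR.zpow (-1))
  push_cast at this
  linarith

/-- Twelve iterations give `F = c ^ 12 F`; multiplying by `F ^ 11` avoids dividing at a zero. -/
theorem pow_twelve_smul_of_finite_order {F : ℍ → ℂ} {γ : SL(2, ℤ)} (hγ : γ ^ 12 = 1) {c : ℂ}
    (h : ∀ τ, F (γ • τ) = c * F τ) (τ : ℍ) : F (γ • τ) ^ 12 = F τ ^ 12 := by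
  have hn : ∀ n : ℕ, F (γ ^ n • τ) = c ^ n * F τ := fun n => by
    induction n with
    | zero => simp
    | succ n ih => rw [pow_succ', mul_smul, h, ih, pow_succ', mul_assoc]
  have h12 := hn 12
  rw [hγ, one_smul] at h12
  rw [h, mul_pow]
  linear_combination -(F τ ^ 11) * h12

/-- The twelfth power of a function with a character of `SL(2, ℤ)` is invariant. -/
theorem pow_twelve_smul {F : ℍ → ℂ} (hinv : ∀ γ : SL(2, ℤ), ∃ c : ℂ, c ≠ 0 ∧ ∀ τ, F (γ • τ) = c * F τ)
    (γ : SL(2, ℤ)) (τ : ℍ) : F (γ • τ) ^ 12 = F τ ^ 12 := by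
  let H : Subgroup SL(2, ℤ) :=
    { carrier := {γ | ∀ τ, F (γ • τ) ^ 12 = F τ ^ 12}
      one_mem' := fun τ => by rw [one_smul]
      mul_mem' := fun {a b} ha hb τ => by rw [mul_smul, ha, hb]
      inv_mem' := fun {a} ha τ => by rw [← ha, smul_inv_smul] }
  have hfin : ∀ γ : SL(2, ℤ), γ ^ 12 = 1 → γ ∈ H := fun γ hγ => by
    obtain ⟨c, -, hc⟩ := hinv γ
    exact pow_twelve_smul_of_finite_order hγ hc
  -- `S` and `S * T` have orders dividing 12 and generate `SL(2, ℤ)`.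
  have hS : ModularGroup.S ∈ H := hfin _ (by decide)
  have hST : ModularGroup.S * ModularGroup.T ∈ H := hfin _ (by decide)
  have hle : Subgroup.closure {ModularGroup.S, ModularGroup.T} ≤ H := by
    rw [Subgroup.closure_le]
    rintro x (rfl | rfl)
    · exact hS
    · exact (Subgroup.mul_mem_cancel_left _ hS).1 hST
  rw [SpecialLinearGroup.SL2Z_generators] at hle
  exact hle (Subgroup.mem_top γ) τ

theorem ordAt_jInv_sub_smul (γ : SL(2, ℤ)) (τ : ℍ) :
    ordAt (fun σ => jInv σ - jInv τ) (γ • τ) = (Nat.card (barStabilizer ⊤ (Sum.inl τ)) : ℤ) := by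
  rw [← ordAt_comp_smul]
  simp_rw [jInv_smul]
  exact ordAt_jInv_sub τ

theorem ordAt_jInv_sub_eq_zero {σ τ : ℍ} (h : ¬ ∃ γ : SL(2, ℤ), γ • τ = σ) :
    ordAt (fun σ => jInv σ - jInv τ) σ = 0 :=
  ordAt_eq_zero_of_ne_zero (mdiff_jInv_sub _)
    (sub_ne_zero.2 fun h' => h (exists_smul_eq_of_jInv_eq h'))

/-- The degree formula for functions with a character of `SL(2, ℤ)`. -/
theorem sum_ord_div_card_add_exponent {F : ℍ → ℂ} (hF : IsMero F)
    (hinv : ∀ γ : SL(2, ℤ), ∃ c : ℂ, c ≠ 0 ∧ ∀ τ, F (γ • τ) = c * F τ) {R : ℝ}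
    (hR : HasExponent F R) (n : ℍ → ℤ) (hn : ∀ τ, ordAt F τ = n τ) (s : Finset ℍ)
    (hs : ∀ y ∈ s, ∀ z ∈ s, ∀ γ : SL(2, ℤ), γ • y = z → y = z)
    (hcov : ∀ y, n y ≠ 0 → ∃ z ∈ s, ∃ γ : SL(2, ℤ), γ • z = y) :
    ∑ τ ∈ s, (n τ : ℝ) / Nat.card (barStabilizer ⊤ (Sum.inl τ)) + R = 0 := by
  classical
  set e : ℍ → ℕ := fun τ => Nat.card (barStabilizer ⊤ (Sum.inl τ)) with he
  have he0 : ∀ τ, e τ ≠ 0 := fun τ => (card_barStabilizer_mem τ).1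
  have hdvd : ∀ τ, e τ ∣ 12 := fun τ => (card_barStabilizer_mem τ).2.trans (by norm_num)
  choose m hm using hdvd
  have hninv : ∀ (γ : SL(2, ℤ)) τ, n (γ • τ) = n τ := fun γ τ => by
    obtain ⟨c, hc, h⟩ := hinv γ
    have := ordAt_smul_of_eq_const_mul hF hc h τ
    rw [hn, hn] at this
    exact_mod_cast this
  have hJ : ∀ τ : ℍ, IsMero fun σ => jInv σ - jInv τ := fun τ =>
    isMero_of_mdiff (mdiff_jInv_sub _)
  have hP : ∀ τ ∈ s, IsMero fun σ => (jInv σ - jInv τ) ^ (-(n τ * m τ)) := fun τ _ => (hJ τ).zpow _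
  -- With `12 = e τ * m τ`, the factor at `τ` has order `-(n τ * m τ) * e τ = -12 n τ` there and
  -- cancels that of `F ^ 12`. The exponent of the product is `12 R + ∑ n τ * m τ`.
  have key := exponent_eq_zero_of_invariant ((hF.pow 12).mul (IsMero.prod s hP)) (fun σ => ?_)
    (fun γ τ => by simp_rw [jInv_smul, pow_twelve_smul hinv])
    ((hR.pow 12).mul (HasExponent.prod s fun τ _ => (hasExponent_jInv_sub (jInv τ)).zpow _))
  · have h12 : ∀ τ, (12 : ℝ) = e τ * m τ := fun τ => by exact_mod_cast hm τ
    have : ∑ τ ∈ s, (n τ : ℝ) / e τ =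
        (∑ τ ∈ s, ((-(n τ * m τ) : ℤ) : ℝ) * -1) / 12 := by
      rw [Finset.sum_div]
      refine Finset.sum_congr rfl fun τ _ => ?_
      have := he0 τ
      rw [h12 τ] 
      have hm0 : (m τ : ℝ) ≠ 0 := fun h => by have := h12 τ; simp [h] at this
      push_cast
      field_simp
    rw [this]
    push_cast at key ⊢
    linarith
  · rw [ordAt_mul (hF.pow 12) (IsMero.prod s hP), ordAt_prod s hP, ordAt_pow hF, hn]
    by_cases hσ : ∃ z ∈ s, ∃ γ : SL(2, ℤ), γ • z = σ
    · obtain ⟨z, hz, γ, rfl⟩ := hσ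
      rw [Finset.sum_eq_single z, ordAt_zpow (hJ z), ordAt_jInv_sub_smul, hninv]
      · have h12 : (12 : ℤ) = e z * m z := by exact_mod_cast hm z
        have h0 : 12 * n z + -(n z * m z) * (e z : ℤ) = 0 := by linear_combination n z * h12
        change ((12 : ℤ) : WithTop ℤ) * (n z : WithTop ℤ) +
          ((-(n z * m z) : ℤ) : WithTop ℤ) * ((e z : ℤ) : WithTop ℤ) = 0
        rw [← WithTop.coe_mul, ← WithTop.coe_mul, ← WithTop.coe_add, h0]
        rfl
      · intro y hy hyz
        rw [ordAt_zpow (hJ y), ordAt_jInv_sub_eq_zero, mul_zero]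
        rintro ⟨δ, hδ⟩
        refine hyz (hs y hy z hz (γ⁻¹ * δ) ?_)
        rw [mul_smul, hδ, inv_smul_smul]
      · exact fun h => absurd hz h
    · have h0 : n σ = 0 := by
        by_contra h
        exact hσ (hcov σ h)
      rw [h0, Finset.sum_eq_zero]
      · simp
      · intro y hy
        rw [ordAt_zpow (hJ y), ordAt_jInv_sub_eq_zero, mul_zero]
        exact fun ⟨γ, h⟩ => hσ ⟨y, hy, γ, h⟩

/-- A function with an exponent has finitely many zeros and poles in the fundamental domain. -/
theorem finite_ordAt_ne_zero_fd {F : ℍ → ℂ} (hF : IsMero F) {R : ℝ} (hR : HasExponent F R) :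
    {τ : ℍ | τ ∈ ModularGroup.fd ∧ ordAt F τ ≠ 0}.Finite := by
  obtain ⟨A, hA⟩ := exists_ordAt_eq_zero hR
  refine Set.Finite.of_finite_image (f := ((↑) : ℍ → ℂ)) ?_ coe_injective.injOn
  -- Above height `A` there are no zeros or poles, and on the compact remainder of the fundamental
  -- domain they form a discrete set.
  set K : Set ℂ := (↑) '' ModularGroup.truncatedFundamentalDomain A with hK
  have hKc : IsCompact K := (ModularGroup.isCompact_truncatedFundamentalDomain A).image
    continuous_coe
  have hKU : MeromorphicOn (F ∘ ofComplex) K := by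
    rintro _ ⟨τ, -, rfl⟩
    exact hF τ
  have hne : ∀ u ∈ K, meromorphicOrderAt (F ∘ ofComplex) u ≠ ⊤ := by
    rintro _ ⟨τ, -, rfl⟩
    exact ordAt_ne_top hF hR τ
  refine (hKc.finite_sdiff_of_mem_codiscreteWithin
    (hKU.codiscreteWithin_setOfPred_meromorphicOrderAt_eq_zero_or_top hne)).subset ?_
  rintro _ ⟨τ, ⟨hτ, h0⟩, rfl⟩
  refine ⟨⟨τ, ⟨hτ, ?_⟩, rfl⟩, fun h => ?_⟩
  · by_contra! h
    exact h0 (hA τ h)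
  · exact h.2.elim h0 (ordAt_ne_top hF hR τ)

end

end RationalWeight

namespace RationalWeight

noncomputable section

/-! ### The weight zero function attached to a modular form of rational weight -/

/-- The function `f ^ (12 D) / Δ ^ j`, which has weight zero if `f` has weight `j / D`. -/
def weightZero (D : ℕ) (j : ℤ) (f : ℍ → ℂ) (τ : ℍ) : ℂ :=
  f τ ^ (12 * D) * ModularForm.discriminant τ ^ (-j)

theorem smul_infty_eq_iff {γ : SL(2, ℤ)} : γ • (∞ : OnePoint ℚ) = ∞ ↔ γ 1 0 = 0 := by
  change Matrix.SpecialLinearGroup.mapGL ℚ γ • (∞ : OnePoint ℚ) = ∞ ↔ _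
  rw [OnePoint.smul_infty_eq_self_iff]
  simp

theorem exists_smul_infty_eq (x : OnePoint ℚ) : ∃ γ : SL(2, ℤ), γ • (∞ : OnePoint ℚ) = x :=
  OnePoint.exists_mem_SL2 ℤ x

section WeightZero

variable {D : ℕ} [NeZero D] {j : ℤ} {G : Subgroup SL(2, ℤ)} {χ : coverOf D G →* Circle} {f : ℍ → ℂ}

/-- The power `-12 D j` of the root is `(c τ + d) ^ (-12 j)`, which is exactly the factor acquired
by `Δ ^ (-j)`. -/
theorem weightZero_smul (g : DCover D) (τ : ℍ) :
    weightZero D j f (g.mat • τ) =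
      slash j f g τ ^ (12 * D) * ModularForm.discriminant τ ^ (-j) := by
  rw [weightZero, slash, discriminant_smul, ← autFactor_eq_denom, ← g.root_pow, mul_pow, mul_zpow,
    ← pow_mul, mul_comm D 12, ← zpow_natCast (g.root τ ^ (-j)), ← zpow_mul, mul_comm (-j), zpow_mul,
    zpow_natCast]
  ring

theorem hasExponent_weightZero {γ : SL(2, ℤ)} {r : ℝ}
    (h : HasOrderAtInfty (slash j f (DCover.lift D γ)) r) :
    HasExponent (fun τ => weightZero D j f (γ • τ)) (12 * D * r - j) := by
  have h1 := (h.hasExponent.pow (12 * D)).mul (hasExponent_discriminant.zpow (-j))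
  have h2 : 12 * D * r - j = (12 * D : ℕ) * r + (-j : ℤ) * 1 := by
    push_cast
    ring
  rw [h2]
  exact h1.congr' (Filter.Eventually.of_forall fun τ => (weightZero_smul (DCover.lift D γ) τ).symm)

namespace IsMeromorphicModularForm

theorem exists_order (hf : IsMeromorphicModularForm D j G χ f) (hf0 : f ≠ 0) (γ : SL(2, ℤ)) :
    ∃ r : ℝ, HasOrderAtInfty (slash j f (DCover.lift D γ)) r := by
  refine (hf.meromorphic_at_cusps (DCover.lift D γ)).resolve_left fun h => hf0 (funext fun τ => ?_)
  have h1 := (mul_eq_zero.1 (h (γ⁻¹ • τ))).resolve_left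
    (zpow_ne_zero _ ((DCover.lift D γ).root_ne_zero _))
  rwa [show (DCover.lift D γ).mat = γ from rfl, smul_inv_smul] at h1

theorem lift_mem_coverOf {g : SL(2, ℤ)} (hg : g ∈ G) : DCover.lift D g ∈ coverOf D G := hg

theorem weightZero_smul_of_mem (hf : IsMeromorphicModularForm D j G χ f) {g : SL(2, ℤ)} (hg : g ∈ G)
    (τ : ℍ) : weightZero D j f (g • τ) =
      (χ ⟨DCover.lift D g, lift_mem_coverOf hg⟩ : ℂ) ^ (12 * D) * weightZero D j f τ := by
  have h := hf.slash_eq ⟨DCover.lift D g, lift_mem_coverOf hg⟩ τ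
  have h1 := weightZero_smul (j := j) (f := f) (DCover.lift D g) τ
  rw [h, mul_pow, mul_assoc] at h1
  exact h1

/-- Since `-I` acts trivially on the half plane, passing to `±G` costs nothing in weight zero, and
`χ` need not be extended. -/
theorem exists_weightZero_smul (hf : IsMeromorphicModularForm D j G χ f) {g : SL(2, ℤ)}
    (hg : g ∈ withCenter G) :
    ∃ c : ℂ, c ≠ 0 ∧ ∀ τ, weightZero D j f (g • τ) = c * weightZero D j f τ := by
  obtain ⟨g, hg', z, hz, rfl⟩ := mem_withCenter.1 hg
  refine ⟨_, pow_ne_zero (12 * D) (χ ⟨DCover.lift D g, lift_mem_coverOf hg'⟩).coe_ne_zero, fun τ => ?_⟩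
  have hz' : z • τ = τ := Sum.inl_injective (center_smul hz (Sum.inl τ))
  rw [mul_smul, hz', hf.weightZero_smul_of_mem hg']

theorem isMero_weightZero (hf : IsMeromorphicModularForm D j G χ f) : IsMero (weightZero D j f) :=
  (hf.meromorphic.isMero.pow _).mul ((isMero_of_mdiff mdiff_discriminant).zpow _)

theorem ordAt_weightZero (hf : IsMeromorphicModularForm D j G χ f) (τ : ℍ) :
    ordAt (weightZero D j f) τ = (12 * D : ℕ) * ordAt f τ := by
  have hΔ := isMero_of_mdiff mdiff_discriminant
  have := ordAt_mul (hf.meromorphic.isMero.pow (12 * D)) (hΔ.zpow (-j)) τ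
  rw [ordAt_pow hf.meromorphic.isMero, ordAt_zpow hΔ, ordAt_discriminant, mul_zero, add_zero] at this
  exact this

theorem exists_ordAt_eq (hf : IsMeromorphicModularForm D j G χ f) (hf0 : f ≠ 0) (τ : ℍ) :
    ∃ n : ℤ, ordAt f τ = n := by
  obtain ⟨r, hr⟩ := hf.exists_order hf0 1
  have h1 := hasExponent_weightZero hr
  simp_rw [one_smul] at h1
  have h2 := ordAt_ne_top hf.isMero_weightZero h1 τ
  rw [hf.ordAt_weightZero] at h2
  refine (WithTop.ne_top_iff_exists.1 fun h => h2 ?_).imp fun _ h => h.symm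
  rw [h]
  exact WithTop.mul_top (by
    have := NeZero.ne D
    exact_mod_cast mul_ne_zero (by norm_num) this)

theorem ordAt_weightZero_eq (hf : IsMeromorphicModularForm D j G χ f) {n : ℍ → ℤ}
    (hn : ∀ τ, ordAt f τ = n τ) (τ : ℍ) :
    ordAt (weightZero D j f) τ = ((12 * D * n τ : ℤ) : WithTop ℤ) := by
  rw [hf.ordAt_weightZero, hn, WithTop.coe_mul]
  rfl

theorem order_smul (hf : IsMeromorphicModularForm D j G χ f) {n : ℍ → ℤ}
    (hn : ∀ τ, ordAt f τ = n τ) {g : SL(2, ℤ)} (hg : g ∈ withCenter G) (τ : ℍ) :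
    n (g • τ) = n τ := by
  obtain ⟨c, hc, h⟩ := hf.exists_weightZero_smul hg
  have h1 := ordAt_smul_of_eq_const_mul hf.isMero_weightZero hc h τ
  rw [hf.ordAt_weightZero_eq hn, hf.ordAt_weightZero_eq hn] at h1
  have h2 : 12 * D * n (g • τ) = 12 * D * n τ := WithTop.coe_injective h1
  refine mul_left_cancel₀ ?_ h2
  have := NeZero.ne D
  exact_mod_cast mul_ne_zero (by norm_num) this

/-- The order at a cusp does not depend on the choice of a matrix. -/
theorem order_at_cusp_eq (hf : IsMeromorphicModularForm D j G χ f) {g γ γ' : SL(2, ℤ)}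
    (hg : g ∈ withCenter G) (h : g • γ • (∞ : OnePoint ℚ) = γ' • (∞ : OnePoint ℚ)) {r r' : ℝ}
    (hr : HasOrderAtInfty (slash j f (DCover.lift D γ)) r)
    (hr' : HasOrderAtInfty (slash j f (DCover.lift D γ')) r') : r' = r := by
  have h1 : (γ'⁻¹ * g * γ) • (∞ : OnePoint ℚ) = ∞ := by
    rw [mul_smul, mul_smul, h, inv_smul_smul]
  -- A matrix fixing `∞` acts as a translation, and translations and constant factors preserve
  -- exponents.
  obtain ⟨n, hn⟩ := ModularGroup.exists_eq_T_zpow_of_c_eq_zero (smul_infty_eq_iff.1 h1)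
  obtain ⟨c, hc, hg'⟩ := hf.exists_weightZero_smul hg
  have e1 := (hasExponent_weightZero hr).const_mul hc
  have e2 := (hasExponent_weightZero hr').vadd n
  have e3 : (fun τ : ℍ => weightZero D j f (γ' • ((n : ℝ) +ᵥ τ))) =
      fun τ => c * weightZero D j f (γ • τ) := by
    funext τ
    rw [← hg', ← modular_T_zpow_smul, ← hn, mul_smul, mul_smul, smul_inv_smul]
  rw [e3] at e2
  have h2 := e2.unique e1
  have : (D : ℝ) ≠ 0 := by exact_mod_cast NeZero.ne D
  have h3 : (D : ℝ) * r' = D * r := by linarith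
  exact mul_left_cancel₀ this h3

/-- If the character has finite order on every element, the orders at the cusps are rational. -/
theorem exists_rat_order_at_cusp [G.FiniteIndex] (hf : IsMeromorphicModularForm D j G χ f)
    (hχ : ∀ g, IsOfFinOrder (χ g)) {γ : SL(2, ℤ)} {r : ℝ}
    (hr : HasOrderAtInfty (slash j f (DCover.lift D γ)) r) : ∃ q : ℚ, r = q := by
  -- A positive power of the conjugate of `T` lies in `G`, so the translate has quasi-period `w`
  -- with factor a power of a value of `χ`. If that value has order dividing `M`, then `M (12 D r -
  -- j) w` is an integer.
  obtain ⟨w, hw, -, hmem⟩ := Subgroup.exists_pow_mem_of_index_ne_zero (H := G)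
    Subgroup.FiniteIndex.index_ne_zero (γ * ModularGroup.T * γ⁻¹)
  rw [conj_pow] at hmem
  obtain ⟨M, hM, hχM⟩ := isOfFinOrder_iff_pow_eq_one.1 (hχ ⟨DCover.lift D _, lift_mem_coverOf hmem⟩)
  have h1 := (hasExponent_weightZero hr).exp_eq_of_vadd (w : ℝ) fun τ => by
    rw [← hf.weightZero_smul_of_mem hmem]
    congr 1
    have : ((w : ℕ) : ℝ) +ᵥ τ = ModularGroup.T ^ w • τ := by
      have := modular_T_zpow_smul τ w
      simpa using this.symm
    rw [this, mul_smul, mul_smul, inv_smul_smul]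
  have h2 := congrArg (fun z : ℂ => z ^ M) h1
  beta_reduce at h2
  have h3 : (χ ⟨DCover.lift D (γ * ModularGroup.T ^ w * γ⁻¹), lift_mem_coverOf hmem⟩ : ℂ) ^ M = 1 := by
    rw [← Circle.coe_pow, hχM, Circle.coe_one]
  rw [← pow_mul, mul_comm _ M, pow_mul, h3, one_pow, ← Complex.exp_nat_mul,
    Complex.exp_eq_one_iff] at h2
  obtain ⟨m, hm⟩ := h2
  have hπ : (2 * Real.pi * Complex.I : ℂ) ≠ 0 := Complex.two_pi_I_ne_zero
  have h4 : ((M * (12 * D * r - j) * w : ℝ) : ℂ) = ((m : ℝ) : ℂ) := by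
    refine mul_right_cancel₀ hπ ?_
    push_cast at hm ⊢
    linear_combination hm
  have h5 : (M * (12 * D * r - j) * w : ℝ) = m := Complex.ofReal_injective h4
  have hM0 : (M : ℝ) ≠ 0 := by exact_mod_cast hM.ne'
  have hw0 : (w : ℝ) ≠ 0 := by exact_mod_cast hw.ne'
  have hD0 : (D : ℝ) ≠ 0 := by exact_mod_cast NeZero.ne D
  refine ⟨((m : ℚ) / (M * w) + j) / (12 * D), ?_⟩
  push_cast
  rw [← h5]
  field_simp
  ring

end IsMeromorphicModularForm

end WeightZero

/-! ### The divisor -/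

theorem ModularCurve.exists_mk_eq {G : Subgroup SL(2, ℤ)} (x : ModularCurve G) :
    ∃ y, ModularCurve.mk G y = x := Quotient.exists_rep x

/-- A function on the extended upper half plane that is invariant under `±G` descends to the
modular curve. -/
theorem exists_descent {G : Subgroup SL(2, ℤ)} (a : ExtUHP → ℝ)
    (ha : ∀ g ∈ withCenter G, ∀ y, a (g • y) = a y) :
    ∃ b : ModularCurve G → ℝ, ∀ y, b (ModularCurve.mk G y) = a y := by
  choose o ho using ModularCurve.exists_mk_eq (G := G)
  refine ⟨fun x => a (o x), fun y => ?_⟩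
  obtain ⟨g, hg, h⟩ := mk_eq_mk_iff.1 (ho (ModularCurve.mk G y))
  change a (o _) = _
  rw [← h, ha g hg]

theorem relIndex_stabilizer_smul (G : Subgroup SL(2, ℤ)) {g : SL(2, ℤ)} (hg : g ∈ withCenter G)
    (y : ExtUHP) : (withCenter G).relIndex (MulAction.stabilizer SL(2, ℤ) (g • y)) =
      (withCenter G).relIndex (MulAction.stabilizer SL(2, ℤ) y) := by
  have h := ncard_coset_fiber G 1 y
  rw [one_smul] at h
  rw [← h, ← ncard_coset_fiber, mk_eq_mk_iff.2 ⟨g, hg, rfl⟩]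

instance finiteIndex_withCenter (G : Subgroup SL(2, ℤ)) [G.FiniteIndex] :
    (withCenter G).FiniteIndex :=
  Subgroup.finiteIndex_of_le le_sup_left

section Divisor

variable {D : ℕ} [NeZero D] {j : ℤ} {G : Subgroup SL(2, ℤ)} {χ : coverOf D G →* Circle} {f : ℍ → ℂ}

namespace IsMeromorphicModularForm

/-- The local data of a modular form: the orders divided by the orders of the stabilizers in the
full modular group, and the orders at the cusps. -/
theorem exists_local_order (hf : IsMeromorphicModularForm D j G χ f) {n : ℍ → ℤ}
    (hn : ∀ τ, ordAt f τ = n τ) {r : SL(2, ℤ) → ℝ}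
    (hr : ∀ γ, HasOrderAtInfty (slash j f (DCover.lift D γ)) (r γ)) :
    ∃ a : ModularCurve G → ℝ,
      (∀ τ, a (ModularCurve.mk G (Sum.inl τ)) =
        n τ / Nat.card (barStabilizer ⊤ (Sum.inl τ))) ∧
      ∀ γ, a (ModularCurve.mk G (Sum.inr (γ • (∞ : OnePoint ℚ)))) = r γ := by
  choose γ hγ using exists_smul_infty_eq
  obtain ⟨a, ha⟩ := exists_descent (G := G)
    (Sum.elim (fun τ => (n τ : ℝ) / Nat.card (barStabilizer ⊤ (Sum.inl τ))) fun x => r (γ x)) (by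
      rintro g hg (τ | x)
      · have hc := card_barStabilizer_top_smul g (Sum.inl τ)
        rw [Sum.smul_inl] at hc ⊢
        rw [Sum.elim_inl, Sum.elim_inl, hf.order_smul hn hg, hc]
      · rw [Sum.smul_inr, Sum.elim_inr, Sum.elim_inr]
        exact hf.order_at_cusp_eq hg (by rw [hγ, hγ]) (hr (γ x)) (hr (γ (g • x))))
  refine ⟨a, fun τ => ha _, fun δ => ?_⟩
  rw [ha, Sum.elim_inr]
  exact hf.order_at_cusp_eq (one_mem _) (by rw [one_smul, hγ]) (hr δ) (hr _)

variable [G.FiniteIndex]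

/-- The product of the weight zero function over the cosets of `±G` has a character of
`SL(2, ℤ)`. -/
theorem exists_prod_weightZero_smul (hf : IsMeromorphicModularForm D j G χ f) (γ : SL(2, ℤ)) :
    ∃ c : ℂ, c ≠ 0 ∧ ∀ τ : ℍ,
      ∏ q : SL(2, ℤ) ⧸ withCenter G, weightZero D j f (q.out⁻¹ • γ • τ) =
        c * ∏ q : SL(2, ℤ) ⧸ withCenter G, weightZero D j f (q.out⁻¹ • τ) := by
  have h : ∀ q : SL(2, ℤ) ⧸ withCenter G, ∃ c : ℂ, c ≠ 0 ∧ ∀ τ : ℍ,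
      weightZero D j f (q.out⁻¹ • γ • τ) = c * weightZero D j f ((γ⁻¹ • q).out⁻¹ • τ) := fun q => by
    -- Left multiplication by `γ⁻¹` permutes the cosets; the chosen representatives change by
    -- elements of `±G`, which cost only constants.
    obtain ⟨g, hg⟩ := QuotientGroup.mk_out_eq_mul (withCenter G) (γ⁻¹ * q.out)
    have hq : ((γ⁻¹ * q.out : SL(2, ℤ)) : SL(2, ℤ) ⧸ withCenter G) = γ⁻¹ • q := by
      conv_rhs => rw [← QuotientGroup.out_eq' q]
      rfl
    rw [hq] at hg
    obtain ⟨c, hc, h⟩ := hf.exists_weightZero_smul g.2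
    refine ⟨c, hc, fun τ => ?_⟩
    rw [← h, hg, ← mul_smul, ← mul_smul]
    congr 2
    group
  choose c hc h using h
  refine ⟨∏ q, c q, Finset.prod_ne_zero_iff.2 fun q _ => hc q, fun τ => ?_⟩
  simp_rw [h, Finset.prod_mul_distrib]
  congr 1
  exact Equiv.prod_comp (MulAction.toPerm γ⁻¹)
    fun q : SL(2, ℤ) ⧸ withCenter G => weightZero D j f (q.out⁻¹ • τ)

/-- Finitely many points, inequivalent under `SL(2, ℤ)`, represent all zeros and poles. -/
theorem exists_representatives (hf : IsMeromorphicModularForm D j G χ f) {n : ℍ → ℤ}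
    (hn : ∀ τ, ordAt f τ = n τ) {r : SL(2, ℤ) → ℝ}
    (hr : ∀ γ, HasOrderAtInfty (slash j f (DCover.lift D γ)) (r γ)) :
    ∃ s : Finset ℍ, (∀ y ∈ s, ∀ z ∈ s, ∀ γ : SL(2, ℤ), γ • y = z → y = z) ∧
      ∀ y, n y ≠ 0 → ∃ z ∈ s, ∃ γ : SL(2, ℤ), γ • z = y := by
  classical
  -- A zero or pole `y` of `f` moved into the fundamental domain by `δ` becomes one of the translate
  -- belonging to the coset of `δ`, so finitely many translates account for all.
  have hfin : (⋃ q : SL(2, ℤ) ⧸ withCenter G, {τ : ℍ | τ ∈ ModularGroup.fd ∧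
      ordAt (fun σ => weightZero D j f (q.out⁻¹ • σ)) τ ≠ 0}).Finite :=
    Set.finite_iUnion fun q => finite_ordAt_ne_zero_fd (hf.isMero_weightZero.comp_smul _)
      (hasExponent_weightZero (hr _))
  set p : ℍ → ℍ := fun τ => (Quotient.mk (MulAction.orbitRel SL(2, ℤ) ℍ) τ).out with hp
  have hpm : ∀ τ, ∃ γ : SL(2, ℤ), γ • τ = p τ := fun τ =>
    (Quotient.mk_out (s := MulAction.orbitRel SL(2, ℤ) ℍ) τ)
  have hpe : ∀ (γ : SL(2, ℤ)) τ, p (γ • τ) = p τ := fun γ τ => by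
    have : Quotient.mk (MulAction.orbitRel SL(2, ℤ) ℍ) (γ • τ) = Quotient.mk _ τ :=
      Quotient.sound (MulAction.mem_orbit τ γ)
    rw [hp]
    exact congrArg Quotient.out this
  refine ⟨hfin.toFinset.image p, ?_, fun y hy => ?_⟩
  · intro y hy z hz γ h
    obtain ⟨y, -, rfl⟩ := Finset.mem_image.1 hy
    obtain ⟨z, -, rfl⟩ := Finset.mem_image.1 hz
    obtain ⟨α, hα⟩ := hpm y
    obtain ⟨β, hβ⟩ := hpm z
    rw [← hpe α y, hα, ← hpe γ, h, ← hβ, hpe, hβ]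
  · obtain ⟨δ, hδ⟩ := ModularGroup.exists_smul_mem_fd y
    obtain ⟨γ, hγ⟩ := hpm (δ • y)
    refine ⟨p (δ • y), Finset.mem_image_of_mem p (hfin.mem_toFinset.2 (Set.mem_iUnion.2
      ⟨(δ : SL(2, ℤ) ⧸ withCenter G), hδ, ?_⟩)), δ⁻¹ * γ⁻¹, ?_⟩
    · obtain ⟨g, hg⟩ := QuotientGroup.mk_out_eq_mul (withCenter G) δ
      rw [ordAt_comp_smul, hf.ordAt_weightZero_eq hn, hg, mul_inv_rev, mul_smul, inv_smul_smul,
        hf.order_smul hn (inv_mem g.2)]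
      have := NeZero.ne D
      have h2 : 12 * D * n y ≠ 0 :=
        mul_ne_zero (by exact_mod_cast mul_ne_zero (by norm_num) this) hy
      exact WithTop.coe_ne_zero.2 h2
    · rw [← hγ, mul_smul, inv_smul_smul, inv_smul_smul]

/-- The divisor of a modular form and its degree. -/
theorem exists_divisor (hf : IsMeromorphicModularForm D j G χ f) {n : ℍ → ℤ}
    (hn : ∀ τ, ordAt f τ = n τ) {r : SL(2, ℤ) → ℝ}
    (hr : ∀ γ, HasOrderAtInfty (slash j f (DCover.lift D γ)) (r γ)) :
    ∃ d : ModularCurve G →₀ ℝ,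
      (∀ τ, d (ModularCurve.mk G (Sum.inl τ)) = n τ / Nat.card (barStabilizer G (Sum.inl τ))) ∧
      (∀ γ, d (ModularCurve.mk G (Sum.inr (γ • (∞ : OnePoint ℚ)))) =
        r γ * width G (γ • (∞ : OnePoint ℚ))) ∧
      12 * D * degree d = (withCenter G).index * j := by
  classical
  obtain ⟨a, ha, ha'⟩ := hf.exists_local_order hn hr
  obtain ⟨s, hs, hcov⟩ := hf.exists_representatives hn hr
  obtain ⟨b, hb⟩ := exists_descent (G := G) (fun y => a (ModularCurve.mk G y) *
    (withCenter G).relIndex (MulAction.stabilizer SL(2, ℤ) y)) fun g hg y => by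
      rw [relIndex_stabilizer_smul G hg, mk_eq_mk_iff.2 ⟨g, hg, rfl⟩]
  -- All cusps are equivalent under `SL(2, ℤ)`, so `∞` alone represents them.
  have hcov' : ∀ y, b (ModularCurve.mk G y) ≠ 0 →
      ∃ z ∈ s.disjSum {(∞ : OnePoint ℚ)}, ∃ γ : SL(2, ℤ), γ • z = y := by
    rintro (τ | x) hy
    · rw [hb, ha] at hy
      obtain ⟨z, hz, γ, h⟩ := hcov τ fun h => hy (by simp [h])
      exact ⟨Sum.inl z, Finset.inl_mem_disjSum.2 hz, γ, congrArg Sum.inl h⟩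
    · obtain ⟨γ, h⟩ := exists_smul_infty_eq x
      exact ⟨Sum.inr ∞, Finset.inr_mem_disjSum.2 (by simp), γ, congrArg Sum.inr h⟩
  have hfin : b.support.Finite := by
    refine Set.Finite.subset (Finset.finite_toSet ((s.disjSum {(∞ : OnePoint ℚ)}).biUnion fun z =>
      Finset.univ.image fun q : SL(2, ℤ) ⧸ withCenter G => ModularCurve.mk G (q.out⁻¹ • z))) ?_
    intro x hx
    obtain ⟨y, rfl⟩ := x.exists_mk_eq
    obtain ⟨z, hz, γ, rfl⟩ := hcov' y hx
    refine Finset.mem_coe.2 (Finset.mem_biUnion.2 ⟨z, hz, Finset.mem_image.2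
      ⟨((γ⁻¹ : SL(2, ℤ)) : SL(2, ℤ) ⧸ withCenter G), Finset.mem_univ _, ?_⟩⟩)
    rw [mk_out_inv_smul, inv_inv]
  set d : ModularCurve G →₀ ℝ := Finsupp.ofSupportFinite b hfin with hd
  have hdb : ∀ x, d x = b x := fun x => rfl
  refine ⟨d, fun τ => ?_, fun γ => ?_, ?_⟩
  · rw [hdb, hb, ha, ← card_barStabilizer_mul G (Sum.inl τ)]
    have h0 := (card_barStabilizer_mem τ).1
    rw [← card_barStabilizer_mul G (Sum.inl τ)] at h0
    have h1 := left_ne_zero_of_mul h0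
    have h2 := right_ne_zero_of_mul h0
    push_cast
    field_simp
  · rw [hdb, hb, ha', width, relIndex_barStabilizer]
  · have h1 := sum_eq_sum_cosets G a d (fun y => by rw [hdb, hb]) (s.disjSum {(∞ : OnePoint ℚ)}) (by
      rintro (y | y) hy (z | z) hz γ h
      · rw [hs y (Finset.inl_mem_disjSum.1 hy) z (Finset.inl_mem_disjSum.1 hz) γ
          (Sum.inl_injective h)]
      · cases h
      · cases h
      · rw [Finset.mem_singleton.1 (Finset.inr_mem_disjSum.1 hy),
          Finset.mem_singleton.1 (Finset.inr_mem_disjSum.1 hz)]) fun y hy => hcov' y hy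
    have hmero : ∀ q ∈ (Finset.univ : Finset (SL(2, ℤ) ⧸ withCenter G)),
        IsMero fun τ => weightZero D j f (q.out⁻¹ • τ) :=
      fun q _ => hf.isMero_weightZero.comp_smul _
    -- Level one formula for the product over the cosets. Its exponent is the sum of `12 D r - j`
    -- over the cosets, which brings in the index times `j`.
    have h2 := sum_ord_div_card_add_exponent (IsMero.prod Finset.univ hmero)
      hf.exists_prod_weightZero_smul
      (HasExponent.prod Finset.univ fun q _ => hasExponent_weightZero (hr q.out⁻¹))
      (fun τ => ∑ q : SL(2, ℤ) ⧸ withCenter G, 12 * D * n (q.out⁻¹ • τ)) (fun τ => by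
        rw [ordAt_prod _ hmero]
        simp_rw [ordAt_comp_smul, hf.ordAt_weightZero_eq hn]
        exact (WithTop.coe_sum _ _).symm) s hs (fun y hy => by
        obtain ⟨q, -, hq⟩ := Finset.exists_ne_zero_of_sum_ne_zero hy
        obtain ⟨z, hz, γ, h⟩ := hcov _ (right_ne_zero_of_mul hq)
        refine ⟨z, hz, q.out * γ, ?_⟩
        rw [mul_smul, h, smul_inv_smul])
    have h3 : ∀ τ, ∑ q : SL(2, ℤ) ⧸ withCenter G, a (ModularCurve.mk G (q.out⁻¹ • Sum.inl τ)) =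
        (∑ q : SL(2, ℤ) ⧸ withCenter G, (n (q.out⁻¹ • τ) : ℝ)) /
          Nat.card (barStabilizer ⊤ (Sum.inl τ)) := fun τ => by
      rw [Finset.sum_div]
      refine Finset.sum_congr rfl fun q _ => ?_
      rw [← card_barStabilizer_top_smul q.out⁻¹]
      exact ha _
    have h4 : ∑ q : SL(2, ℤ) ⧸ withCenter G, a (ModularCurve.mk G (q.out⁻¹ • Sum.inr ∞)) =
        ∑ q : SL(2, ℤ) ⧸ withCenter G, r q.out⁻¹ := Finset.sum_congr rfl fun q _ => ha' _
    rw [h1, Finset.sum_disjSum, Finset.sum_singleton, h4]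
    simp_rw [h3]
    rw [Finset.sum_sub_distrib, ← Finset.mul_sum, Finset.sum_const, Finset.card_univ, nsmul_eq_mul,
      ← Nat.card_eq_fintype_card, ← Subgroup.index_eq_card] at h2
    have h5 : ∑ τ ∈ s, ((∑ q : SL(2, ℤ) ⧸ withCenter G, 12 * D * n (q.out⁻¹ • τ) : ℤ) : ℝ) /
          Nat.card (barStabilizer ⊤ (Sum.inl τ)) =
        12 * D * ∑ τ ∈ s, (∑ q : SL(2, ℤ) ⧸ withCenter G, (n (q.out⁻¹ • τ) : ℝ)) /
          Nat.card (barStabilizer ⊤ (Sum.inl τ)) := by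
      rw [Finset.mul_sum]
      refine Finset.sum_congr rfl fun τ _ => ?_
      push_cast
      rw [← Finset.mul_sum, mul_div_assoc]
    rw [h5] at h2
    linear_combination h2

end IsMeromorphicModularForm

end Divisor

end

end RationalWeight

/-! ### The valence formula for rational weights. -/

open RationalWeight in
theorem theorem3p1 (D : ℕ) [NeZero D] (k : ℚ) (j : ℤ) (hk : (D : ℚ) * k = j)
    (G : Subgroup SL(2, ℤ)) [G.FiniteIndex] (χ : coverOf D G →* Circle)
    (f : ℍ → ℂ) (hf : IsMeromorphicModularForm D j G χ f) (hf0 : f ≠ 0) :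
    ∃ d : ModularCurve G →₀ ℝ,
      (∀ d' : ModularCurve G → ℝ, IsDivisorOf D j G f d' ↔ d' = d) ∧
      degree d = (bar G).index * k / 12 ∧
      ((∀ g, IsOfFinOrder (χ g)) → ∀ x, ∃ q : ℚ, d x = q) := by
  choose n hn using hf.exists_ordAt_eq hf0
  choose r hr using hf.exists_order hf0
  obtain ⟨d, hd, hd', hdeg⟩ := hf.exists_divisor hn hr
  refine ⟨d, fun d' => ⟨fun h => funext fun x => ?_, ?_⟩, ?_, fun hχ x => ?_⟩
  · obtain ⟨τ | y, rfl⟩ := x.exists_mk_eq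
    · obtain ⟨m, hm, h1⟩ := h.at_point τ
      have : m = n τ := by
        have := hm.symm.trans (hn τ)
        exact_mod_cast this
      rw [h1, hd, this]
    · obtain ⟨γ, rfl⟩ := exists_smul_infty_eq y
      obtain ⟨r', hr', h1⟩ := h.at_cusp γ
      -- The order in `IsDivisorOf` is only asserted to exist; uniqueness of exponents identifies it
      -- with the chosen `r γ`.
      rw [h1, hd', hr'.hasExponent.unique (hr γ).hasExponent]
  · rintro rfl
    exact ⟨fun τ => ⟨n τ, hn τ, hd τ⟩, fun γ => ⟨r γ, hr γ, hd' γ⟩⟩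
  · have hD : (D : ℝ) ≠ 0 := by exact_mod_cast NeZero.ne D
    have hk' : (D : ℝ) * k = j := by exact_mod_cast hk
    rw [index_bar]
    refine mul_left_cancel₀ (mul_ne_zero (by norm_num : (12 : ℝ) ≠ 0) hD) ?_
    rw [hdeg, ← hk']
    ring
  · obtain ⟨τ | y, rfl⟩ := x.exists_mk_eq
    · exact ⟨n τ / Nat.card (barStabilizer G (Sum.inl τ)), by rw [hd]; push_cast; rfl⟩
    · obtain ⟨γ, rfl⟩ := exists_smul_infty_eq y
      obtain ⟨q, hq⟩ := hf.exists_rat_order_at_cusp hχ (hr γ)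
      exact ⟨q * width G (γ • (∞ : OnePoint ℚ)), by rw [hd', hq]; push_cast; rfl⟩
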